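/- Let $p\ge 1$, $B>0$, and let $\theta^\star\in\mathbb R^p$ with $\|\theta^\star\|_2\le B$. Let $(\mathcal X_t)_{t\ge1}$ be deterministic decision sets contained in the closed Euclidean unit ball of $\mathbb R^p$. In round $t$ an agent plays $X_t\in\mathcal X_t$ and observes $Y_t=\langle\theta^\star,X_t\rangle+\varepsilon_t$. Put $\mathcal F_t=\sigma(\varepsilon_1,\dots,\varepsilon_t)$. Assume that the noise is mixing sub-Gaussian (with $\sigma=1$) with respect to a non-negative, non-increasing sequence $(\phi_k)_{k\ge0}$: every $\varepsilon_t$ is centred and $1$-sub-Gaussian, and for all $k\ge1$, $t>k$ and $\lambda'\in\mathbb R$, almost surely $$\big|\mathbb E[\varepsilon_t\mid\mathcal F_{t-k}]\big|\le\phi_k,\qquad \mathbb E\big[e^{\lambda'(\varepsilon_t-\mathbb E[\varepsilon_t\mid\mathcal F_{t-k}])}\,\big|\,\mathcal F_{t-k}\big]\le e^{\lambda'^2/2}.$$ Fix $\lambda=1/B^2$, an integer delay $d\ge1$ and $\delta\in(0,1)$. For $t\ge1$ let $$\beta_t^2=dp\log\frac{(B+1)^2e\max(dp,t+d)}{dp}+4\lambda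 B^2+2t\phi_d(B+1)+2d\log\frac d\delta,\qquad V_t=\sum_{s=1}^tX_sX_s^\top+\lambda\,\mathrm{Id},$$ let $\widehat\theta_t$ be a minimiser of $\sum_{s=1}^t(\langle\theta,X_s\rangle-Y_s)^2$ over $\{\|\theta\|_2\le B\}$, and let $$\mathcal C_t=\{\theta:\|\theta\|_2\le B,\ \langle\theta-\widehat\theta_t,V_t(\theta-\widehat\theta_t)\rangle\le\beta_t^2\}.$$ Mixing-LinUCB plays arbitrary deterministic arms $X_t\in\mathcal X_t$ in rounds $t\le d$, and in each round $t>d$ it plays an $\mathcal F_{t-d}$-measurable maximiser $X_t$ of $x\mapsto\max_{\theta\in\mathcal C_{t-d}}\langle x,\theta\rangle$ over $\mathcal X_t$. Let $\mathrm{Reg}(T)=\sum_{t=1}^T\sup_{x\in\mathcal X_t}\big(\langle x,\theta^\star\rangle-\langle X_t,\theta^\star\rangle\big)$. Then, with probability at least $1-\delta$, simultaneously for all integers $T>d$, $$\mathrm{Reg}(T)\le 2dB+\sqrt{8dpT\max(B^2,\beta_T^2)\log\Big(1+\frac{B^2T}{dp}\Big)}.$$ -/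

import Mathlib

open MeasureTheory ProbabilityTheory
open scoped NNReal

noncomputable section

namespace MixingBandit

/-- The space `ℝ^p` with its Euclidean norm and dot product. -/
abbrev Vec (p : ℕ) := EuclideanSpace ℝ (Fin p)

/-- `F_t = σ(ε_1, …, ε_t)`; in particular `F_0` is the trivial σ-algebra. -/
abbrev noiseSigma {Ω : Type*} (ε : ℕ → Ω → ℝ) (t : ℕ) : MeasurableSpace Ω :=
  ⨆ s ∈ Finset.Icc 1 t, MeasurableSpace.comap (ε s) inferInstance

/-- `(σ, φ)`-mixing sub-Gaussianity of the noise `(ε_t)_{t ≥ 1}`. Every variable in `condSubgaussian`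
whose conditional expectation is taken is integrable, by `subgaussian` and `condMean`. -/
structure IsMixingSubGaussian {Ω : Type*} [MeasurableSpace Ω] (μ : Measure Ω)
    (ε : ℕ → Ω → ℝ) (σ : ℝ≥0) (φ : ℕ → ℝ) : Prop where
  coeff_nonneg : ∀ k, 0 ≤ φ k
  coeff_antitone : Antitone φ
  measurable : ∀ t, 1 ≤ t → Measurable (ε t)
  centred : ∀ t, 1 ≤ t → ∫ ω, ε t ω ∂μ = 0
  subgaussian : ∀ t, 1 ≤ t → HasSubgaussianMGF (ε t) (σ ^ 2) μ
  condMean : ∀ k t : ℕ, 1 ≤ k → k < t →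
    ∀ᵐ ω ∂μ, |(μ[ε t | noiseSigma ε (t - k)]) ω| ≤ φ k
  condSubgaussian : ∀ k t : ℕ, 1 ≤ k → k < t → ∀ l : ℝ,
    ∀ᵐ ω ∂μ,
      (μ[fun ω' => Real.exp (l * (ε t ω' - (μ[ε t | noiseSigma ε (t - k)]) ω')) |
        noiseSigma ε (t - k)]) ω ≤ Real.exp (l ^ 2 * (σ : ℝ) ^ 2 / 2)

/-- The reward `Y_t = ⟨θ⋆, X_t⟩ + ε_t`. -/
def reward {Ω : Type*} {p : ℕ} (θs : Vec p) (ε : ℕ → Ω → ℝ) (X : ℕ → Ω → Vec p)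
    (t : ℕ) (ω : Ω) : ℝ :=
  inner ℝ θs (X t ω) + ε t ω

/-- The weighted (semi-)norm `‖u‖_A = √⟨u, A u⟩`. -/
def weightedNorm {p : ℕ} (A : Matrix (Fin p) (Fin p) ℝ) (u : Vec p) : ℝ :=
  √(u.ofLp ⬝ᵥ A.mulVec u.ofLp)

/-- `V_t = ∑_{s=1}^t X_s X_sᵀ + lam • Id`, for one realisation `x` of the arms. -/
def featureCov {p : ℕ} (lam : ℝ) (x : ℕ → Vec p) (t : ℕ) : Matrix (Fin p) (Fin p) ℝ :=
  (∑ s ∈ Finset.Icc 1 t, Matrix.vecMulVec (x s).ofLp (x s).ofLp) + lam • (1 : Matrix _ _ ℝ)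

/-- `θ` minimises `∑_{s=1}^t (⟨θ, X_s⟩ - Y_s)²` over the closed ball of radius `B`. -/
def IsLeastSquares {p : ℕ} (B : ℝ) (x : ℕ → Vec p) (y : ℕ → ℝ) (t : ℕ) (θ : Vec p) : Prop :=
  θ ∈ Metric.closedBall (0 : Vec p) B ∧
    IsMinOn (fun θ' : Vec p => ∑ s ∈ Finset.Icc 1 t, (inner ℝ θ' (x s) - y s) ^ 2)
      (Metric.closedBall (0 : Vec p) B) θ

/-- The squared radius
`β_t² = dp log((B+1)² e max(dp, t+d) / (dp)) + 4 lam B² + 2 t φ_d (B+1) + 2 d log(d/δ)`. -/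
def radiusSq (p d : ℕ) (B lam δ : ℝ) (φ : ℕ → ℝ) (t : ℕ) : ℝ :=
  d * p * Real.log ((B + 1) ^ 2 * Real.exp 1 * max ((d : ℝ) * p) (t + d) / (d * p))
    + 4 * lam * B ^ 2 + 2 * t * φ d * (B + 1) + 2 * d * Real.log (d / δ)

/-- The confidence set
`C_t = {θ ∈ 𝓑(B) : ½‖θ - θ̂_t‖²_{V_t} ≤ β_t² / 2}`, centred at `θhat`, for one realisation `x` of the
arms. -/
def confSet {p : ℕ} (d : ℕ) (B lam δ : ℝ) (φ : ℕ → ℝ) (x : ℕ → Vec p) (θhat : Vec p)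
    (t : ℕ) : Set (Vec p) :=
  {θ | θ ∈ Metric.closedBall (0 : Vec p) B ∧
    1 / 2 * weightedNorm (featureCov lam x t) (θ - θhat) ^ 2 ≤
      d * p / 2 * Real.log ((B + 1) ^ 2 * Real.exp 1 * max ((d : ℝ) * p) (t + d) / (d * p))
        + 2 * lam * B ^ 2 + t * φ d * (B + 1) + d * Real.log (d / δ)}

/-- `UCB_C(x) = max_{θ ∈ C} ⟨x, θ⟩`. -/
def ucb {p : ℕ} (C : Set (Vec p)) (x : Vec p) : ℝ :=
  sSup ((fun θ : Vec p => (inner ℝ x θ : ℝ)) '' C)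

/-- `X` is the (random) sequence of arms played by Mixing-LinUCB with delay `d` on the decision sets
`D_t`: the first `d` arms are arbitrary but fixed, and afterwards `X_t` is a maximiser over `D_t` of
the upper confidence bound built on `C_{t-d}`. `θhat t` is any choice of the constrained least-squares
estimator, and ties are broken using the first `t - d` rounds only. -/
structure IsMixingLinUCB {Ω : Type*} {p : ℕ} (ε : ℕ → Ω → ℝ) (θs : Vec p)
    (D : ℕ → Set (Vec p)) (d : ℕ) (B lam δ : ℝ) (φ : ℕ → ℝ)
    (X θhat : ℕ → Ω → Vec p) : Prop where
  mem : ∀ t, 1 ≤ t → ∀ ω, X t ω ∈ D t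
  init : ∀ t, 1 ≤ t → t ≤ d → ∃ x₀ : Vec p, ∀ ω, X t ω = x₀
  adapted : ∀ t, d < t → Measurable[noiseSigma ε (t - d)] (X t)
  leastSquares : ∀ t, 1 ≤ t → ∀ ω,
    IsLeastSquares B (fun s => X s ω) (fun s => reward θs ε X s ω) t (θhat t ω)
  optimistic : ∀ t, d < t → ∀ ω, ∀ x ∈ D t,
    ucb (confSet d B lam δ φ (fun s => X s ω) (θhat (t - d) ω) (t - d)) x ≤
      ucb (confSet d B lam δ φ (fun s => X s ω) (θhat (t - d) ω) (t - d)) (X t ω)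

/-- `Reg(T) = ∑_{t=1}^T sup_{x ∈ D_t} (⟨x, θ⋆⟩ - ⟨X_t, θ⋆⟩)`, for one realisation `x` of the arms. -/
def regret {p : ℕ} (θs : Vec p) (D : ℕ → Set (Vec p)) (x : ℕ → Vec p) (T : ℕ) : ℝ :=
  ∑ t ∈ Finset.Icc 1 T, ⨆ a : D t, (inner ℝ (a : Vec p) θs - inner ℝ (x t) θs)

end MixingBandit

end

/-! Rounds congruent modulo `d` form `d` interleaved blocks. Consecutive rounds of a block are `d`
apart and `X_t` is `F_{t-d}`-measurable. So within a block the noise, centred by its mean given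
`F_{t-d}`, is conditionally sub-Gaussian and the arms are predictable. A Gaussian mixture of the
likelihood ratios of all `θ` against `θ⋆` is then a nonnegative supermartingale. Ville's inequality
at level `δ/d` per block and a union bound (`measure_badEvent_le`) control all likelihood ratios at
once, for all times (`sum_logRatio_le`).

Evaluating this at the least-squares estimator, whose first-order optimality bounds its squared
prediction error by a noise sum (`IsLeastSquares.sum_sq_le`), gives a confidence bound. The
conditional mean of the noise adds a bias of at most `φ_d ∑ |⟨θ̂ - θ⋆, X_s⟩|`. The radius allows
only `B + 1` per round for these inner products, while a priori they may reach `2B`. Hence `θ⋆` may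
be missed, but only in rounds `t` with `t - d` small against the noise radius (`mem_confSet_or`),
and these are few (`card_filter_mul_le`).

In the other rounds, optimism bounds the regret by the confidence width. The matrix `V_{t-d}`
dominates the covariance of the earlier rounds in the block of `t`, so one elliptical potential per
block absorbs the delay (`inner_sq_le_blockPotential_mul`, `sum_blockPotential_le`). Cauchy–Schwarz
over rounds concludes. The constant 8 splits as 6 for the potentials plus 2 for the missed rounds.
The latter needs `K = dp log(1 + B²T/(dp)) ≥ 3` and a small `φ_d`; both hold unless the claim
already follows from the trivial bound `2BT`. -/

namespace MixingBandit

/-! ### Conditional exponential moments and Ville's inequality. -/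

section Supermartingale

variable {Ω : Type*} {m mΩ : MeasurableSpace Ω} {μ : Measure Ω}

/-- `ξ` is conditionally `1`-sub-Gaussian given `m`. -/
structure CondSubgaussian (m : MeasurableSpace Ω) {mΩ : MeasurableSpace Ω} (μ : Measure Ω)
    (ξ : Ω → ℝ) : Prop where
  measurable : Measurable ξ
  integrable : ∀ l : ℝ, Integrable (fun ω => Real.exp (l * ξ ω)) μ
  condExp_le : ∀ l : ℝ, ∀ᵐ ω ∂μ,
    (μ[fun ω' => Real.exp (l * ξ ω') | m]) ω ≤ Real.exp (l ^ 2 / 2)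

/-- First stage towards predictable multipliers `v`. Pulling `v` out of a conditional expectation
would need `exp (v ξ)` integrable, which may fail for unbounded `v`; with `[0, ∞]`-valued integrals
one passes instead from constants to finitely many values, and then to limits by Fatou. -/
lemma CondSubgaussian.setLIntegral_const_le [IsProbabilityMeasure μ] (hm : m ≤ mΩ) {ξ : Ω → ℝ}
    (h : CondSubgaussian m μ ξ) (l : ℝ) {A : Set Ω} (hA : MeasurableSet[m] A) :
    ∫⁻ ω in A, ENNReal.ofReal (Real.exp (l * ξ ω - l ^ 2 / 2)) ∂μ ≤ μ A := by
  have h1 : ∫ ω in A, Real.exp (l * ξ ω) ∂μ ≤ Real.exp (l ^ 2 / 2) * μ.real A := by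
    rw [← setIntegral_condExp hm (h.integrable l) hA]
    calc _ ≤ ∫ ω in A, Real.exp (l ^ 2 / 2) ∂μ :=
          setIntegral_mono_ae integrable_condExp.integrableOn (integrable_const _).integrableOn
            (h.condExp_le l)
      _ = _ := by simp [mul_comm]
  have h2 : ∫ ω in A, Real.exp (l * ξ ω - l ^ 2 / 2) ∂μ ≤ μ.real A := by
    simp_rw [sub_eq_add_neg, Real.exp_add]
    rw [integral_mul_const]
    calc _ ≤ Real.exp (l ^ 2 / 2) * μ.real A * Real.exp (-(l ^ 2 / 2)) := by gcongr
      _ = μ.real A := by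
        rw [mul_right_comm, ← Real.exp_add]; simp
  have h3 : Integrable (fun ω => Real.exp (l * ξ ω - l ^ 2 / 2)) (μ.restrict A) := by
    simp_rw [sub_eq_add_neg, Real.exp_add]
    exact ((h.integrable l).mul_const _).integrableOn
  rw [← ofReal_integral_eq_lintegral_ofReal h3 (ae_of_all _ fun _ => (Real.exp_pos _).le)]
  calc _ ≤ ENNReal.ofReal (μ.real A) := ENNReal.ofReal_le_ofReal h2
    _ = μ A := by simp

lemma CondSubgaussian.setLIntegral_finite_range_le [IsProbabilityMeasure μ] (hm : m ≤ mΩ)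
    {ξ : Ω → ℝ} (h : CondSubgaussian m μ ξ) {v : Ω → ℝ} (hv : Measurable[m] v)
    {R : Finset ℝ} (hR : ∀ ω, v ω ∈ R) {A : Set Ω}
    (hA : MeasurableSet[m] A) :
    ∫⁻ ω in A, ENNReal.ofReal (Real.exp (v ω * ξ ω - v ω ^ 2 / 2)) ∂μ ≤ μ A := by
  have hAU : A = ⋃ y ∈ R, A ∩ v ⁻¹' {y} := by
    ext ω; simp [hR]
  have hd : Set.PairwiseDisjoint (↑R) fun y => A ∩ v ⁻¹' {y} := by
    intro y _ z _ hyz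
    refine Set.disjoint_left.2 fun ω h1 h2 => hyz ?_
    rw [← h1.2, ← h2.2]
  have hmeas : ∀ y, MeasurableSet[m] (A ∩ v ⁻¹' {y}) := fun y =>
    hA.inter (hv (measurableSet_singleton y))
  calc _ = ∑ y ∈ R, ∫⁻ ω in A ∩ v ⁻¹' {y},
            ENNReal.ofReal (Real.exp (v ω * ξ ω - v ω ^ 2 / 2)) ∂μ := by
        conv_lhs => rw [hAU]
        rw [lintegral_biUnion_finset hd fun y _ => hm _ (hmeas y)]
    _ = ∑ y ∈ R, ∫⁻ ω in A ∩ v ⁻¹' {y},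
            ENNReal.ofReal (Real.exp (y * ξ ω - y ^ 2 / 2)) ∂μ := by
        refine Finset.sum_congr rfl fun y _ => setLIntegral_congr_fun (hm _ (hmeas y)) ?_
        intro ω hω
        have : v ω = y := hω.2
        simp only [this]
    _ ≤ ∑ y ∈ R, μ (A ∩ v ⁻¹' {y}) :=
        Finset.sum_le_sum fun y _ => h.setLIntegral_const_le hm y (hmeas y)
    _ = μ A := by
        conv_rhs => rw [hAU]
        rw [measure_biUnion_finset hd fun y _ => hm _ (hmeas y)]

lemma CondSubgaussian.setLIntegral_le [IsProbabilityMeasure μ] (hm : m ≤ mΩ)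
    {ξ : Ω → ℝ} (h : CondSubgaussian m μ ξ) {v : Ω → ℝ} (hv : Measurable[m] v) {A : Set Ω}
    (hA : MeasurableSet[m] A) :
    ∫⁻ ω in A, ENNReal.ofReal (Real.exp (v ω * ξ ω - v ω ^ 2 / 2)) ∂μ ≤ μ A := by
  have hs : StronglyMeasurable[m] v := hv.stronglyMeasurable
  have hξ := h.measurable
  have hlim : ∀ ω, Filter.Tendsto
      (fun n => ENNReal.ofReal (Real.exp (hs.approx n ω * ξ ω - hs.approx n ω ^ 2 / 2)))
      Filter.atTop (nhds (ENNReal.ofReal (Real.exp (v ω * ξ ω - v ω ^ 2 / 2)))) := by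
    intro ω
    have h1 := hs.tendsto_approx ω
    have hc : Continuous fun y : ℝ => ENNReal.ofReal (Real.exp (y * ξ ω - y ^ 2 / 2)) :=
      ENNReal.continuous_ofReal.comp (by fun_prop)
    exact (hc.tendsto _).comp h1
  calc _ = ∫⁻ ω in A, Filter.liminf (fun n =>
            ENNReal.ofReal (Real.exp (hs.approx n ω * ξ ω - hs.approx n ω ^ 2 / 2)))
            Filter.atTop ∂μ := by
        refine lintegral_congr fun ω => (hlim ω).liminf_eq.symm
    _ ≤ Filter.liminf (fun n => ∫⁻ ω in A,
            ENNReal.ofReal (Real.exp (hs.approx n ω * ξ ω - hs.approx n ω ^ 2 / 2)) ∂μ)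
            Filter.atTop := by
        refine lintegral_liminf_le fun n => ?_
        have : Measurable (hs.approx n) := (@SimpleFunc.measurable _ _ m _ (hs.approx n)).mono hm le_rfl
        fun_prop
    _ ≤ Filter.liminf (fun _ : ℕ => μ A) Filter.atTop :=
        Filter.liminf_le_liminf (Filter.Eventually.of_forall fun n =>
          h.setLIntegral_finite_range_le hm (@SimpleFunc.measurable _ _ m _ (hs.approx n))
            (fun ω => @SimpleFunc.mem_range_self _ _ m (hs.approx n) ω) hA)
    _ = μ A := by simp

/-- On `m`-measurable sets, the measure with the exponential as density is dominated by `μ`, so the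
same comparison holds when integrating any `m`-measurable `Z`. -/
lemma CondSubgaussian.lintegral_mul_le [IsProbabilityMeasure μ] (hm : m ≤ mΩ)
    {ξ : Ω → ℝ} (h : CondSubgaussian m μ ξ) {v : Ω → ℝ} (hv : Measurable[m] v)
    {Z : Ω → ENNReal} (hZ : Measurable[m] Z) :
    ∫⁻ ω, Z ω * ENNReal.ofReal (Real.exp (v ω * ξ ω - v ω ^ 2 / 2)) ∂μ ≤ ∫⁻ ω, Z ω ∂μ := by
  set f : Ω → ENNReal := fun ω => ENNReal.ofReal (Real.exp (v ω * ξ ω - v ω ^ 2 / 2)) with hf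
  have hfm : Measurable f := by
    have := h.measurable
    have := hv.mono hm le_rfl
    fun_prop
  have hle : (μ.withDensity f).trim hm ≤ μ.trim hm := by
    refine @Measure.le_iff Ω m _ _ |>.2 fun A hA => ?_
    rw [trim_measurableSet_eq hm hA, trim_measurableSet_eq hm hA, withDensity_apply _ (hm _ hA)]
    exact h.setLIntegral_le hm hv hA
  calc _ = ∫⁻ ω, Z ω ∂(μ.withDensity f) := by
        rw [lintegral_withDensity_eq_lintegral_mul _ hfm (hZ.mono hm le_rfl)]
        simp [hf, mul_comm]
    _ = ∫⁻ ω, Z ω ∂((μ.withDensity f).trim hm) := (lintegral_trim hm hZ).symm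
    _ ≤ ∫⁻ ω, Z ω ∂(μ.trim hm) := lintegral_mono' hle le_rfl
    _ = _ := lintegral_trim hm hZ

/-- **Ville's inequality** for a nonnegative supermartingale with values in `[0, ∞]`. -/
lemma ville_inequality {G : ℕ → MeasurableSpace Ω} (hG : ∀ n, G n ≤ mΩ) (hmono : Monotone G)
    {W : ℕ → Ω → ENNReal} (hW : ∀ n, Measurable[G n] (W n))
    (hstep : ∀ n A, MeasurableSet[G n] A → ∫⁻ ω in A, W (n + 1) ω ∂μ ≤ ∫⁻ ω in A, W n ω ∂μ)
    (h0 : ∫⁻ ω, W 0 ω ∂μ ≤ 1) (c : ENNReal) :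
    c * μ {ω | ∃ n, c ≤ W n ω} ≤ 1 := by
  set A : ℕ → Set Ω := fun n => {ω | ∃ k ≤ n, c ≤ W k ω} with hAdef
  have hAm : ∀ n, MeasurableSet[G n] (A n) := by
    intro n
    have : A n = ⋃ k ∈ Set.Iic n, {ω | c ≤ W k ω} := by ext ω; simp [hAdef]
    rw [this]
    refine @MeasurableSet.biUnion Ω ℕ (G n) _ _ (Set.to_countable _) fun k hk => ?_
    exact hmono hk _ (hW k measurableSet_Ici)
  -- The process frozen at level `c` once it has reached `c` still has total mass at most 1.
  have key : ∀ n, c * μ (A n) + ∫⁻ ω in (A n)ᶜ, W n ω ∂μ ≤ 1 := by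
    intro n
    induction n with
    | zero =>
      have hA0 : ∀ ω ∈ A 0, c ≤ W 0 ω := by rintro ω ⟨k, hk, h⟩; obtain rfl : k = 0 := by omega
                                            exact h
      calc _ ≤ ∫⁻ ω in A 0, W 0 ω ∂μ + ∫⁻ ω in (A 0)ᶜ, W 0 ω ∂μ := by
            gcongr
            rw [← setLIntegral_const]
            exact setLIntegral_mono' (hG _ _ (hAm 0)) hA0
        _ = ∫⁻ ω, W 0 ω ∂μ := lintegral_add_compl _ (hG _ _ (hAm 0))
        _ ≤ 1 := h0
    | succ n ih =>
      have hsub : A n ⊆ A (n + 1) := fun ω ⟨k, hk, h⟩ => ⟨k, by omega, h⟩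
      have hdiff : ∀ ω ∈ A (n + 1) \ A n, c ≤ W (n + 1) ω := by
        rintro ω ⟨⟨k, hk, h⟩, hn⟩
        rcases Nat.lt_or_ge n k with hkn | hkn
        · obtain rfl : k = n + 1 := by omega
          exact h
        · exact absurd ⟨k, hkn, h⟩ hn
      have hm1 : MeasurableSet (A (n + 1)) := hG _ _ (hAm _)
      have hm0 : MeasurableSet (A n) := hG _ _ (hAm _)
      have hμ : μ (A (n + 1)) = μ (A n) + μ (A (n + 1) \ A n) := by
        rw [← measure_union Set.disjoint_sdiff_right (hm1.diff hm0), Set.union_sdiff_cancel hsub]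
      have hint : ∫⁻ ω in (A n)ᶜ, W (n + 1) ω ∂μ =
          ∫⁻ ω in A (n + 1) \ A n, W (n + 1) ω ∂μ + ∫⁻ ω in (A (n + 1))ᶜ, W (n + 1) ω ∂μ := by
        rw [← lintegral_union hm1.compl (disjoint_compl_right.mono_left Set.sdiff_subset)]
        congr 2
        ext ω
        have := @hsub ω
        simp only [Set.mem_compl_iff, Set.mem_union, Set.mem_sdiff]
        tauto
      calc _ = c * μ (A n) + (c * μ (A (n + 1) \ A n)
              + ∫⁻ ω in (A (n + 1))ᶜ, W (n + 1) ω ∂μ) := by rw [hμ, mul_add, add_assoc]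
        _ ≤ c * μ (A n) + (∫⁻ ω in A (n + 1) \ A n, W (n + 1) ω ∂μ
              + ∫⁻ ω in (A (n + 1))ᶜ, W (n + 1) ω ∂μ) := by
            gcongr
            rw [← setLIntegral_const]
            exact setLIntegral_mono' (hm1.diff hm0) hdiff
        _ = c * μ (A n) + ∫⁻ ω in (A n)ᶜ, W (n + 1) ω ∂μ := by rw [hint]
        _ ≤ c * μ (A n) + ∫⁻ ω in (A n)ᶜ, W n ω ∂μ := by
            gcongr 1
            exact hstep n _ (@MeasurableSet.compl _ _ (G n) (hAm n))
        _ ≤ 1 := ih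
  have hU : {ω | ∃ n, c ≤ W n ω} = ⋃ n, A n := by
    ext ω
    simp only [hAdef, Set.mem_ofPred_eq, Set.mem_iUnion]
    exact ⟨fun ⟨n, h⟩ => ⟨n, n, le_rfl, h⟩, fun ⟨_, k, _, h⟩ => ⟨k, h⟩⟩
  have hAmono : Monotone A := fun a b hab ω ⟨k, hk, h⟩ => ⟨k, hk.trans hab, h⟩
  rw [hU, hAmono.measure_iUnion, ENNReal.mul_iSup]
  exact iSup_le fun n => le_self_add.trans (key n)

end Supermartingale

/-! ### Lower bound for a Gaussian mixture of likelihood ratios. -/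

section GaussianMixture

variable {p : ℕ} {τ : ℝ}

lemma integral_exp_neg_norm_sq (hτ : 0 < τ) :
    ∫ w : Vec p, Real.exp (-(τ / 2) * ‖w‖ ^ 2) = (2 * Real.pi / τ) ^ ((p : ℝ) / 2) := by
  rw [GaussianFourier.integral_rexp_neg_mul_sq_norm (by positivity)]
  simp only [finrank_euclideanSpace, Fintype.card_fin]
  congr 1
  field_simp

lemma integrable_exp_neg_norm_sq (hτ : 0 < τ) :
    Integrable fun w : Vec p => Real.exp (-(τ / 2) * ‖w‖ ^ 2) := by
  -- A non-integrable function has integral 0 by convention, so a nonzero value proves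
  -- integrability.
  refine not_imp_comm.1 integral_undef ?_
  rw [integral_exp_neg_norm_sq hτ]
  have := Real.pi_pos
  positivity

lemma integrable_norm_sq_mul_exp (hτ : 0 < τ) :
    Integrable fun w : Vec p => ‖w‖ ^ 2 * Real.exp (-(τ / 2) * ‖w‖ ^ 2) := by
  refine ((integrable_exp_neg_norm_sq (p := p) (τ := τ / 2) (by positivity)).const_mul
    (4 / τ)).mono' (by fun_prop) (ae_of_all _ fun w => ?_)
  rw [Real.norm_of_nonneg (by positivity)]
  have h1 : τ / 4 * ‖w‖ ^ 2 ≤ Real.exp (τ / 4 * ‖w‖ ^ 2) := by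
    linarith [Real.add_one_le_exp (τ / 4 * ‖w‖ ^ 2)]
  have h2 : ‖w‖ ^ 2 ≤ 4 / τ * Real.exp (τ / 4 * ‖w‖ ^ 2) := by
    rw [div_mul_eq_mul_div, le_div_iff₀ hτ]; linarith
  calc _ ≤ 4 / τ * Real.exp (τ / 4 * ‖w‖ ^ 2) * Real.exp (-(τ / 2) * ‖w‖ ^ 2) := by gcongr
    _ = _ := by rw [mul_assoc, ← Real.exp_add]; ring_nf

lemma integrable_inner_sq_mul_exp (hτ : 0 < τ) (x : Vec p) :
    Integrable fun w : Vec p => inner ℝ w x ^ 2 * Real.exp (-(τ / 2) * ‖w‖ ^ 2) := by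
  refine ((integrable_norm_sq_mul_exp (p := p) hτ).const_mul
    (‖x‖ ^ 2)).mono' (by fun_prop) (ae_of_all _ fun w => ?_)
  rw [Real.norm_of_nonneg (by positivity), ← mul_assoc]
  gcongr
  rw [← sq_abs, ← mul_pow, mul_comm]
  gcongr
  exact abs_real_inner_le_norm w x

lemma integrable_inner_mul_exp (hτ : 0 < τ) (x : Vec p) :
    Integrable fun w : Vec p => inner ℝ w x * Real.exp (-(τ / 2) * ‖w‖ ^ 2) := by
  refine ((integrable_exp_neg_norm_sq (p := p) hτ).add (integrable_inner_sq_mul_exp hτ x)).mono'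
    (by fun_prop) (ae_of_all _ fun w => ?_)
  rw [norm_mul, Real.norm_of_nonneg (Real.exp_pos _).le, Pi.add_apply, ← one_add_mul]
  gcongr
  rw [Real.norm_eq_abs]
  nlinarith [sq_nonneg (|inner ℝ w x| - 1), sq_abs (inner ℝ w x), abs_nonneg (inner ℝ w x)]

lemma integral_inner_mul_exp (x : Vec p) :
    ∫ w : Vec p, inner ℝ w x * Real.exp (-(τ / 2) * ‖w‖ ^ 2) = 0 := by
  have h := integral_neg_eq_self
    (fun w : Vec p => inner ℝ w x * Real.exp (-(τ / 2) * ‖w‖ ^ 2)) volume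
  simp only [inner_neg_left, norm_neg, neg_mul, integral_neg] at h ⊢
  linarith

/-- The reflection exchanging `x` and `y` preserves both Lebesgue measure and the norm. -/
lemma integral_inner_sq_mul_exp_congr {x y : Vec p} (hxy : ‖x‖ = ‖y‖) :
    ∫ w : Vec p, inner ℝ w x ^ 2 * Real.exp (-(τ / 2) * ‖w‖ ^ 2) =
      ∫ w : Vec p, inner ℝ w y ^ 2 * Real.exp (-(τ / 2) * ‖w‖ ^ 2) := by
  set e : Vec p ≃ₗᵢ[ℝ] Vec p := (ℝ ∙ (x - y))ᗮ.reflection with he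
  have hex : e x = y := Submodule.reflection_sub hxy
  rw [← e.measurePreserving.integral_comp e.toHomeomorph.measurableEmbedding
    (fun w : Vec p => inner ℝ w y ^ 2 * Real.exp (-(τ / 2) * ‖w‖ ^ 2))]
  refine integral_congr_ae (ae_of_all _ fun w => ?_)
  simp only [← hex, LinearIsometryEquiv.inner_map_map, LinearIsometryEquiv.norm_map]

/-- An isotropic Gaussian weight has isotropic second moments. -/
lemma integral_inner_sq_mul_exp (hτ : 0 < τ) (x : Vec p) :
    p * ∫ w : Vec p, inner ℝ w x ^ 2 * Real.exp (-(τ / 2) * ‖w‖ ^ 2) =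
      ‖x‖ ^ 2 * ∫ w : Vec p, ‖w‖ ^ 2 * Real.exp (-(τ / 2) * ‖w‖ ^ 2) := by
  set e : Fin p → Vec p := fun i => EuclideanSpace.single i (1 : ℝ) with he
  have h1 : ∀ i, ∫ w : Vec p, inner ℝ w x ^ 2 * Real.exp (-(τ / 2) * ‖w‖ ^ 2) =
      ‖x‖ ^ 2 * ∫ w : Vec p, inner ℝ w (e i) ^ 2 * Real.exp (-(τ / 2) * ‖w‖ ^ 2) := by
    intro i
    rw [integral_inner_sq_mul_exp_congr (y := ‖x‖ • e i) (by simp [he, norm_smul]),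
      ← integral_const_mul]
    simp only [inner_smul_right, mul_pow, mul_assoc]
  have h2 : ∫ w : Vec p, ‖w‖ ^ 2 * Real.exp (-(τ / 2) * ‖w‖ ^ 2) =
      ∑ i, ∫ w : Vec p, inner ℝ w (e i) ^ 2 * Real.exp (-(τ / 2) * ‖w‖ ^ 2) := by
    rw [← integral_finsetSum _ fun i _ => integrable_inner_sq_mul_exp hτ _]
    refine integral_congr_ae (ae_of_all _ fun w => ?_)
    simp only [← Finset.sum_mul, EuclideanSpace.norm_sq_eq, Real.norm_eq_abs, sq_abs]
    simp [he, EuclideanSpace.inner_single_right]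
  rw [h2, Finset.mul_sum, ← Finset.sum_congr rfl fun i _ => h1 i]
  simp

lemma ofReal_integral_le_lintegral {α : Type*} [MeasurableSpace α] {ν : Measure α} {f : α → ℝ}
    (hf : Integrable f ν) :
    ENNReal.ofReal (∫ a, f a ∂ν) ≤ ∫⁻ a, ENNReal.ofReal (f a) ∂ν := by
  rw [integral_eq_lintegral_pos_part_sub_lintegral_neg_part hf]
  refine (ENNReal.ofReal_le_ofReal (sub_le_self _ ENNReal.toReal_nonneg)).trans ?_
  exact ENNReal.ofReal_toReal_le

/-- Logarithm of the likelihood ratio of `θ` against `θs` after `n` rounds with features `x` and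
noise `z`. -/
noncomputable def logRatio (θs : Vec p) (x : ℕ → Vec p) (z : ℕ → ℝ) (n : ℕ) (θ : Vec p) : ℝ :=
  ∑ j ∈ Finset.range n, (inner ℝ (θ - θs) (x j) * z j - inner ℝ (θ - θs) (x j) ^ 2 / 2)

/-- The centred Gaussian measure with covariance `ρ⁻¹ • Id`. -/
noncomputable def gaussianPrior (p : ℕ) (ρ : ℝ) : Measure (Vec p) :=
  volume.withDensity fun θ =>
    ENNReal.ofReal ((2 * Real.pi / ρ) ^ (-((p : ℝ) / 2)) * Real.exp (-(ρ / 2) * ‖θ‖ ^ 2))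

lemma gaussianPrior_univ {ρ : ℝ} (hρ : 0 < ρ) : gaussianPrior p ρ Set.univ = 1 := by
  have := Real.pi_pos
  rw [gaussianPrior, withDensity_apply _ MeasurableSet.univ, Measure.restrict_univ,
    ← ofReal_integral_eq_lintegral_ofReal ((integrable_exp_neg_norm_sq hρ).const_mul _)
      (ae_of_all _ fun θ => by positivity), integral_const_mul, integral_exp_neg_norm_sq hρ,
    ← Real.rpow_add (by positivity)]
  simp

/-- Exact second-order expansion at `θ`. The linear term is odd in `w`, so it vanishes against a
centred Gaussian. -/
lemma logRatio_add (θs : Vec p) (x : ℕ → Vec p) (z : ℕ → ℝ) (n : ℕ) (ρ : ℝ) (θ w : Vec p) :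
    logRatio θs x z n (θ + w) - ρ / 2 * ‖θ + w‖ ^ 2 =
      (logRatio θs x z n θ - ρ / 2 * ‖θ‖ ^ 2) +
        inner ℝ w (∑ j ∈ Finset.range n, (z j - inner ℝ (θ - θs) (x j)) • x j - ρ • θ)
        - (∑ j ∈ Finset.range n, inner ℝ w (x j) ^ 2) / 2 - ρ / 2 * ‖w‖ ^ 2 := by
  have h : logRatio θs x z n (θ + w) = logRatio θs x z n θ +
      inner ℝ w (∑ j ∈ Finset.range n, (z j - inner ℝ (θ - θs) (x j)) • x j) -
      (∑ j ∈ Finset.range n, inner ℝ w (x j) ^ 2) / 2 := by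
    simp only [logRatio, inner_sum, inner_smul_right, Finset.sum_div]
    rw [← Finset.sum_add_distrib, ← Finset.sum_sub_distrib]
    refine Finset.sum_congr rfl fun j _ => ?_
    rw [add_sub_right_comm, inner_add_left]
    ring
  rw [h, norm_add_sq_real, inner_sub_right, inner_smul_right, real_inner_comm w θ]
  ring

/-- A Gaussian mixture of likelihood ratios dominates each of them up to a penalty. -/
lemma le_lintegral_exp_logRatio (hp : 1 ≤ p) {ρ : ℝ} (hρ : 0 < ρ) (θs : Vec p) {x : ℕ → Vec p}
    (hx : ∀ j, ‖x j‖ ≤ 1) (z : ℕ → ℝ) (n : ℕ) (θ : Vec p) :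
    ENNReal.ofReal (Real.exp (logRatio θs x z n θ - ρ / 2 * ‖θ‖ ^ 2
      - p / 2 * Real.log (1 + n / (ρ * p)))) ≤
      ∫⁻ θ', ENNReal.ofReal (Real.exp (logRatio θs x z n θ')) ∂(gaussianPrior p ρ) := by
  have hpi := Real.pi_pos
  have hp0 : (0 : ℝ) < p := by exact_mod_cast hp
  set s : ℝ := ∑ j ∈ Finset.range n, ‖x j‖ ^ 2 with hs
  have hs0 : 0 ≤ s := Finset.sum_nonneg fun _ _ => by positivity
  have hsn : s ≤ n := by
    calc s ≤ ∑ j ∈ Finset.range n, (1 : ℝ) :=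
          Finset.sum_le_sum fun j _ => pow_le_one₀ (norm_nonneg _) (hx j)
      _ = n := by simp
  -- With this precision the average of `(τ - ρ)/2 ‖w‖²` equals that of `∑ ⟨w, x_j⟩² / 2`: the
  -- isotropic Gaussian replaces the covariance by its trace, and no determinant is needed.
  set τ : ℝ := ρ + s / p with hτdef
  have hτ : 0 < τ := by positivity
  set K : ℝ := logRatio θs x z n θ - ρ / 2 * ‖θ‖ ^ 2 with hK
  set g : Vec p := ∑ j ∈ Finset.range n, (z j - inner ℝ (θ - θs) (x j)) • x j - ρ • θ with hg
  set c : ℝ := (2 * Real.pi / ρ) ^ (-((p : ℝ) / 2)) with hc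
  have hc0 : 0 < c := by positivity
  set γ : Vec p → ℝ := fun w => Real.exp (-(τ / 2) * ‖w‖ ^ 2) with hγ
  have hmeas : Measurable fun θ' : Vec p => ENNReal.ofReal (Real.exp (logRatio θs x z n θ')) := by
    unfold logRatio; fun_prop
  have hI : ∫⁻ θ', ENNReal.ofReal (Real.exp (logRatio θs x z n θ')) ∂(gaussianPrior p ρ) =
      ∫⁻ w : Vec p, ENNReal.ofReal (c * Real.exp (logRatio θs x z n (θ + w)
        - ρ / 2 * ‖θ + w‖ ^ 2)) := by
    rw [gaussianPrior, lintegral_withDensity_eq_lintegral_mul _ (by fun_prop) hmeas,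
      ← lintegral_add_left_eq_self _ θ]
    refine lintegral_congr fun w => ?_
    rw [Pi.mul_apply, ← ENNReal.ofReal_mul (by positivity), mul_assoc, ← Real.exp_add]
    congr 3
    ring
  -- The minorant obtained from `exp y ≥ 1 + y` under the Gaussian weight `γ`; after integration
  -- only the term 1 survives.
  set h : Vec p → ℝ := fun w => c * Real.exp K * (γ w + inner ℝ w g * γ w
    + (τ - ρ) / 2 * (‖w‖ ^ 2 * γ w)
    - (∑ j ∈ Finset.range n, inner ℝ w (x j) ^ 2 * γ w) / 2) with hh
  have hle : ∀ w, h w ≤ c * Real.exp (logRatio θs x z n (θ + w) - ρ / 2 * ‖θ + w‖ ^ 2) := by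
    intro w
    rw [logRatio_add]
    set y : ℝ := inner ℝ w g + (τ - ρ) / 2 * ‖w‖ ^ 2
      - (∑ j ∈ Finset.range n, inner ℝ w (x j) ^ 2) / 2 with hy
    have e1 : h w = c * Real.exp K * (γ w * (y + 1)) := by
      simp only [hh, hy, ← Finset.sum_mul]; ring
    have e2 : Real.exp (K + inner ℝ w g - (∑ j ∈ Finset.range n, inner ℝ w (x j) ^ 2) / 2
        - ρ / 2 * ‖w‖ ^ 2) = Real.exp K * (γ w * Real.exp y) := by
      simp only [hγ, hy]
      rw [← Real.exp_add, ← Real.exp_add]; ring_nf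
    rw [e1, e2, mul_assoc]
    have : 0 < γ w := Real.exp_pos _
    gcongr
    exact Real.add_one_le_exp y
  have i1 : Integrable γ := integrable_exp_neg_norm_sq hτ
  have i2 : Integrable fun w : Vec p => inner ℝ w g * γ w := integrable_inner_mul_exp hτ g
  have i3 : Integrable fun w : Vec p => (τ - ρ) / 2 * (‖w‖ ^ 2 * γ w) :=
    (integrable_norm_sq_mul_exp hτ).const_mul _
  have i4 : Integrable fun w : Vec p =>
      (∑ j ∈ Finset.range n, inner ℝ w (x j) ^ 2 * γ w) / 2 :=
    (integrable_finsetSum _ fun j _ => integrable_inner_sq_mul_exp hτ (x j)).div_const _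
  have i12 : Integrable fun w : Vec p => γ w + inner ℝ w g * γ w := i1.add i2
  have i123 : Integrable fun w : Vec p =>
      γ w + inner ℝ w g * γ w + (τ - ρ) / 2 * (‖w‖ ^ 2 * γ w) := i12.add i3
  have hint : ∫ w, h w = c * Real.exp K * (2 * Real.pi / τ) ^ ((p : ℝ) / 2) := by
    simp only [hh]
    rw [integral_const_mul, integral_sub i123 i4, integral_add i12 i3,
      integral_add i1 i2, integral_inner_mul_exp, integral_exp_neg_norm_sq hτ, integral_const_mul,
      integral_div, integral_finsetSum _ fun j _ => integrable_inner_sq_mul_exp hτ (x j)]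
    have hsum : ∑ j ∈ Finset.range n, ∫ w : Vec p, inner ℝ w (x j) ^ 2 * γ w =
        s / p * ∫ w : Vec p, ‖w‖ ^ 2 * γ w := by
      rw [hs, Finset.sum_div, Finset.sum_mul]
      refine Finset.sum_congr rfl fun j _ => ?_
      rw [div_mul_eq_mul_div, eq_div_iff hp0.ne', ← integral_inner_sq_mul_exp hτ, mul_comm]
    rw [hsum, hτdef]
    ring
  have hconst : Real.exp (K - p / 2 * Real.log (1 + n / (ρ * p))) ≤
      c * Real.exp K * (2 * Real.pi / τ) ^ ((p : ℝ) / 2) := by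
    have e1 : c * (2 * Real.pi / τ) ^ ((p : ℝ) / 2) =
        Real.exp (-(p / 2 * Real.log (τ / ρ))) := by
      rw [hc, Real.rpow_def_of_pos (by positivity), Real.rpow_def_of_pos (by positivity),
        ← Real.exp_add, Real.log_div (by positivity) (by positivity),
        Real.log_div (by positivity) (by positivity), Real.log_div (by positivity) (by positivity)]
      ring_nf
    rw [mul_right_comm, e1, ← Real.exp_add]
    gcongr
    have h1 : Real.log (τ / ρ) ≤ Real.log (1 + n / (ρ * p)) := by
      apply Real.log_le_log (by positivity)
      rw [hτdef, add_div, div_self hρ.ne', div_div, mul_comm (p : ℝ)]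
      gcongr
    have : (p : ℝ) / 2 * Real.log (τ / ρ) ≤ p / 2 * Real.log (1 + n / (ρ * p)) := by gcongr
    linarith
  calc _ ≤ ENNReal.ofReal (∫ w, h w) := ENNReal.ofReal_le_ofReal (hint ▸ hconst)
    _ ≤ ∫⁻ w, ENNReal.ofReal (h w) :=
        ofReal_integral_le_lintegral ((i123.sub i4).const_mul _)
    _ ≤ _ := by
        rw [hI]
        exact lintegral_mono fun w => ENNReal.ofReal_le_ofReal (hle w)

end GaussianMixture

/-! ### Time-uniform control of all likelihood ratios. -/

section SelfNormalized

variable {p : ℕ}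

instance {ρ : ℝ} : SFinite (gaussianPrior p ρ) := by
  unfold gaussianPrior; infer_instance

lemma measurable_logRatio {Ω : Type*} [MeasurableSpace Ω] (θs : Vec p) {x : ℕ → Ω → Vec p}
    {z : ℕ → Ω → ℝ} {n : ℕ} (hx : ∀ j < n, Measurable (x j)) (hz : ∀ j < n, Measurable (z j)) :
    Measurable fun q : Ω × Vec p =>
      logRatio θs (fun j => x j q.1) (fun j => z j q.1) n q.2 := by
  unfold logRatio
  refine Finset.measurable_sum _ fun j hj => ?_
  have h1 := hx j (Finset.mem_range.1 hj)
  have h2 := hz j (Finset.mem_range.1 hj)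
  fun_prop

lemma measurable_exp_logRatio {Ω : Type*} [MeasurableSpace Ω] (θs : Vec p) {x : ℕ → Ω → Vec p}
    {z : ℕ → Ω → ℝ} {n : ℕ} (hx : ∀ j < n, Measurable (x j)) (hz : ∀ j < n, Measurable (z j)) :
    Measurable fun q : Ω × Vec p => ENNReal.ofReal
      (Real.exp (logRatio θs (fun j => x j q.1) (fun j => z j q.1) n q.2)) :=
  (Real.measurable_exp.comp (measurable_logRatio θs hx hz)).ennreal_ofReal

lemma measurable_mixture {Ω : Type*} [MeasurableSpace Ω] (ρ : ℝ) (θs : Vec p) {x : ℕ → Ω → Vec p}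
    {z : ℕ → Ω → ℝ} {n : ℕ} (hx : ∀ j < n, Measurable (x j)) (hz : ∀ j < n, Measurable (z j)) :
    Measurable fun ω => ∫⁻ θ, ENNReal.ofReal
      (Real.exp (logRatio θs (fun j => x j ω) (fun j => z j ω) n θ)) ∂(gaussianPrior p ρ) := by
  exact (measurable_exp_logRatio θs hx hz).lintegral_prod_right'

lemma measurable_exp_logRatio_left {Ω : Type*} [MeasurableSpace Ω] (θs θ : Vec p)
    {x : ℕ → Ω → Vec p} {z : ℕ → Ω → ℝ} {n : ℕ} (hx : ∀ j < n, Measurable (x j))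
    (hz : ∀ j < n, Measurable (z j)) :
    Measurable fun ω => ENNReal.ofReal
      (Real.exp (logRatio θs (fun j => x j ω) (fun j => z j ω) n θ)) := by
  refine (Real.measurable_exp.comp ?_).ennreal_ofReal
  unfold logRatio
  refine Finset.measurable_sum _ fun j hj => ?_
  have h1 := hx j (Finset.mem_range.1 hj)
  have h2 := hz j (Finset.mem_range.1 hj)
  fun_prop

variable {Ω : Type*} {mΩ : MeasurableSpace Ω} {μ : Measure Ω} [IsProbabilityMeasure μ]
  {G : ℕ → MeasurableSpace Ω} {x : ℕ → Ω → Vec p} {z : ℕ → Ω → ℝ} {ρ : ℝ}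

/-- Gaussian mixtures of likelihood ratios satisfy Ville's inequality. -/
lemma mixture_ville (hG : ∀ n, G n ≤ mΩ) (hmono : Monotone G) (θs : Vec p) (hρ : 0 < ρ)
    (hx : ∀ n, Measurable[G n] (x n)) (hz : ∀ n, Measurable[G (n + 1)] (z n))
    (hsub : ∀ n, CondSubgaussian (G n) μ (z n)) (c : ENNReal) :
    c * μ {ω | ∃ n, c ≤ ∫⁻ θ, ENNReal.ofReal
      (Real.exp (logRatio θs (fun j => x j ω) (fun j => z j ω) n θ)) ∂(gaussianPrior p ρ)} ≤ 1 := by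
  have hxm : ∀ n j, j < n → Measurable[G n] (x j) := fun n j h => (hx j).mono (hmono h.le) le_rfl
  have hzm : ∀ n j, j < n → Measurable[G n] (z j) := fun n j h => (hz j).mono (hmono h) le_rfl
  refine ville_inequality hG hmono (fun n => @measurable_mixture p Ω (G n) ρ θs x z n
    (hxm n) (hzm n)) ?_ ?_ c
  · intro n A hA
    have hswap : ∀ n, ∫⁻ ω in A, ∫⁻ θ, ENNReal.ofReal
          (Real.exp (logRatio θs (fun j => x j ω) (fun j => z j ω) n θ)) ∂(gaussianPrior p ρ) ∂μ =
        ∫⁻ θ, ∫⁻ ω in A, ENNReal.ofReal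
          (Real.exp (logRatio θs (fun j => x j ω) (fun j => z j ω) n θ)) ∂μ ∂(gaussianPrior p ρ) := by
      intro n
      refine lintegral_lintegral_swap (Measurable.aemeasurable ?_)
      exact measurable_exp_logRatio θs (fun j _ => (hx j).mono (hG _) le_rfl)
        fun j _ => (hz j).mono (hG _) le_rfl
    -- After Tonelli it suffices to prove the supermartingale step for each fixed `θ`.
    rw [hswap, hswap]
    refine lintegral_mono fun θ => ?_
    rw [← lintegral_indicator (hG n _ hA), ← lintegral_indicator (hG n _ hA)]
    set v : Ω → ℝ := fun ω => inner ℝ (θ - θs) (x n ω) with hv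
    have hvm : Measurable[G n] v := by
      have : Measurable fun y : Vec p => inner ℝ (θ - θs) y := by fun_prop
      exact this.comp (hx n)
    have hLm : Measurable[G n] fun ω => ENNReal.ofReal
        (Real.exp (logRatio θs (fun j => x j ω) (fun j => z j ω) n θ)) :=
      @measurable_exp_logRatio_left p Ω (G n) θs θ x z n (hxm n) (hzm n)
    have := (hsub n).lintegral_mul_le (hG n) hvm (hLm.indicator hA)
    refine le_trans (le_of_eq (lintegral_congr fun ω => ?_)) this
    by_cases hω : ω ∈ A
    · simp only [Set.indicator_of_mem hω]
      rw [← ENNReal.ofReal_mul (Real.exp_pos _).le, ← Real.exp_add, logRatio, logRatio,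
        Finset.sum_range_succ]
    · simp [Set.indicator_of_notMem hω]
  · simp [logRatio, gaussianPrior_univ hρ]

/-- A time-uniform bound for the likelihood ratios, simultaneously over all parameters. -/
lemma measure_logRatio_le (hp : 1 ≤ p) (hG : ∀ n, G n ≤ mΩ) (hmono : Monotone G) (θs : Vec p)
    (hρ : 0 < ρ) (hx : ∀ n, Measurable[G n] (x n)) (hz : ∀ n, Measurable[G (n + 1)] (z n))
    (hsub : ∀ n, CondSubgaussian (G n) μ (z n)) (hx1 : ∀ n ω, ‖x n ω‖ ≤ 1) {η : ℝ} (hη : 0 < η) :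
    μ {ω | ∃ (n : ℕ) (θ : Vec p), ρ / 2 * ‖θ‖ ^ 2 + p / 2 * Real.log (1 + n / (ρ * p)) + Real.log (1 / η) <
      logRatio θs (fun j => x j ω) (fun j => z j ω) n θ} ≤ ENNReal.ofReal η := by
  have h := mixture_ville (μ := μ) hG hmono θs hρ hx hz hsub (ENNReal.ofReal (1 / η))
  have hη' : ENNReal.ofReal (1 / η) = (ENNReal.ofReal η)⁻¹ := by
    rw [one_div, ENNReal.ofReal_inv_of_pos hη]
  have h0 : ENNReal.ofReal η ≠ 0 := by simpa using hη
  rw [hη', ← ENNReal.div_eq_inv_mul,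
    ENNReal.div_le_iff h0 ENNReal.ofReal_ne_top, one_mul] at h
  refine (measure_mono ?_).trans h
  rintro ω ⟨n, θ, hlt⟩
  refine ⟨n, ?_⟩
  rw [← hη']
  refine le_trans (ENNReal.ofReal_le_ofReal ?_) (le_lintegral_exp_logRatio hp hρ θs
    (x := fun j => x j ω) (fun j => hx1 j ω) (fun j => z j ω) n θ)
  rw [← Real.exp_log (show 0 < 1 / η by positivity)]
  gcongr
  linarith

end SelfNormalized

/-! ### Centring the mixing noise. -/

section Noise

variable {Ω : Type*} {ε : ℕ → Ω → ℝ}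

lemma noiseSigma_mono : Monotone (noiseSigma ε) := by
  intro a b hab
  refine iSup₂_le fun s hs => ?_
  refine le_iSup₂_of_le (f := fun s (_ : s ∈ Finset.Icc 1 b) =>
    MeasurableSpace.comap (ε s) inferInstance) s ?_ le_rfl
  simp only [Finset.mem_Icc] at hs ⊢
  omega

lemma noiseSigma_zero : noiseSigma ε 0 = ⊥ := by simp [noiseSigma]

lemma measurable_noise {s t : ℕ} (hs : 1 ≤ s) (hst : s ≤ t) : Measurable[noiseSigma ε t] (ε s) := by
  refine Measurable.mono (comap_measurable (ε s)) ?_ le_rfl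
  exact le_iSup₂_of_le (f := fun s (_ : s ∈ Finset.Icc 1 t) =>
    MeasurableSpace.comap (ε s) inferInstance) s (Finset.mem_Icc.2 ⟨hs, hst⟩) le_rfl

variable {mΩ : MeasurableSpace Ω} {μ : Measure Ω} {φ : ℕ → ℝ}

lemma noiseSigma_le (hε : ∀ t, 1 ≤ t → Measurable (ε t)) (t : ℕ) : noiseSigma ε t ≤ mΩ :=
  iSup₂_le fun s hs => (hε s (Finset.mem_Icc.1 hs).1).comap_le

/-- The noise centred by its conditional mean given the first `t - d` rounds. -/
noncomputable def centredNoise (μ : Measure Ω) (ε : ℕ → Ω → ℝ) (d t : ℕ) (ω : Ω) : ℝ :=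
  ε t ω - (μ[ε t | noiseSigma ε (t - d)]) ω

lemma measurable_centredNoise {d t : ℕ} (ht : 1 ≤ t) :
    Measurable[noiseSigma ε t] (centredNoise μ ε d t) := by
  refine Measurable.sub (measurable_noise ht le_rfl) ?_
  exact stronglyMeasurable_condExp.measurable.mono (noiseSigma_mono (Nat.sub_le _ _)) le_rfl

variable [IsProbabilityMeasure μ]

lemma condMean_le (hε : IsMixingSubGaussian μ ε 1 φ) {d t : ℕ} (hd : 1 ≤ d) (ht : 1 ≤ t) :
    ∀ᵐ ω ∂μ, |(μ[ε t | noiseSigma ε (t - d)]) ω| ≤ φ d := by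
  rcases Nat.lt_or_ge d t with h | h
  · exact hε.condMean d t hd h
  -- In the first `d` rounds `t - d` truncates to 0, so the conditional mean is the plain mean,
  -- which is 0.
  · rw [Nat.sub_eq_zero_of_le h, noiseSigma_zero, condExp_bot, hε.centred t ht]
    simpa using hε.coeff_nonneg d

lemma condSubgaussian_centredNoise (hε : IsMixingSubGaussian μ ε 1 φ) {d t : ℕ} (hd : 1 ≤ d)
    (ht : 1 ≤ t) : CondSubgaussian (noiseSigma ε (t - d)) μ (centredNoise μ ε d t) := by
  have hint : ∀ l : ℝ, Integrable (fun ω => Real.exp (l * centredNoise μ ε d t ω)) μ := by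
    intro l
    have hm : Measurable (centredNoise μ ε d t) :=
      (measurable_centredNoise ht).mono (noiseSigma_le hε.measurable _) le_rfl
    refine (((hε.subgaussian t ht).integrable_exp_mul l).const_mul
      (Real.exp (|l| * φ d))).mono' (by fun_prop) ?_
    filter_upwards [condMean_le hε hd ht] with ω hω
    rw [Real.norm_of_nonneg (Real.exp_pos _).le, ← Real.exp_add]
    gcongr
    have h1 : -(l * (μ[ε t | noiseSigma ε (t - d)]) ω) ≤ |l| * φ d :=
      (neg_le_abs _).trans (by rw [abs_mul]; gcongr)
    simp only [centredNoise]
    linarith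
  refine ⟨(measurable_centredNoise ht).mono (noiseSigma_le hε.measurable _) le_rfl, hint, ?_⟩
  intro l
  rcases Nat.lt_or_ge d t with h | h
  · simpa [centredNoise] using hε.condSubgaussian d t hd h l
  · have e : centredNoise μ ε d t = ε t := by
      ext ω
      rw [centredNoise, Nat.sub_eq_zero_of_le h, noiseSigma_zero, condExp_bot, hε.centred t ht,
        sub_zero]
    rw [e, Nat.sub_eq_zero_of_le h, noiseSigma_zero, condExp_bot]
    refine ae_of_all _ fun ω => ?_
    simpa [mgf] using (hε.subgaussian t ht).mgf_le l

end Noise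

/-! ### Interleaved blocks of rounds. -/

section Blocks

/-- Number of elements of `{1, …, t}` of the form `i + 1 + n * d`. -/
def blockCount (d t i : ℕ) : ℕ := (t + d - 1 - i) / d

lemma lt_blockCount_iff {d t i n : ℕ} (hi : i < d) :
    n < blockCount d t i ↔ i + 1 + n * d ≤ t := by
  rw [blockCount, ← Nat.succ_le_iff, Nat.le_div_iff_mul_le (by omega), Nat.succ_mul]
  omega

/-- Splitting a sum over rounds into `d` interleaved blocks. -/
lemma sum_Icc_eq_sum_blocks {M : Type*} [AddCommMonoid M] {d : ℕ} (hd : 1 ≤ d) (t : ℕ)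
    (f : ℕ → M) :
    ∑ s ∈ Finset.Icc 1 t, f s =
      ∑ i ∈ Finset.range d, ∑ n ∈ Finset.range (blockCount d t i), f (i + 1 + n * d) := by
  rw [Finset.sum_sigma']
  have key : ∀ s, 1 ≤ s → (s - 1) % d + 1 + (s - 1) / d * d = s := fun s hs => by
    have := Nat.mod_add_div' (s - 1) d
    omega
  refine Finset.sum_nbij' (fun s => ⟨(s - 1) % d, (s - 1) / d⟩) (fun q => q.1 + 1 + q.2 * d)
    ?_ ?_ ?_ ?_ ?_
  · intro s hs
    have hs := Finset.mem_Icc.1 hs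
    have hlt := Nat.mod_lt (s - 1) hd
    simp only [Finset.mem_sigma, Finset.mem_range]
    refine ⟨hlt, ?_⟩
    rw [lt_blockCount_iff hlt, key s hs.1]
    exact hs.2
  · rintro ⟨i, n⟩ hq
    simp only [Finset.mem_sigma, Finset.mem_range, Finset.mem_Icc] at hq ⊢
    rw [lt_blockCount_iff hq.1] at hq
    omega
  · intro s hs
    exact key s (Finset.mem_Icc.1 hs).1
  · rintro ⟨i, n⟩ hq
    simp only [Finset.mem_sigma, Finset.mem_range] at hq
    have e : i + 1 + n * d - 1 = i + n * d := by omega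
    simp only [e, Nat.add_mul_mod_self_right, Nat.mod_eq_of_lt hq.1,
      Nat.add_mul_div_right _ _ hd, Nat.div_eq_of_lt hq.1, zero_add]
  · intro s hs
    simp only [key s (Finset.mem_Icc.1 hs).1]

lemma sum_blockCount {d : ℕ} (hd : 1 ≤ d) (t : ℕ) :
    ∑ i ∈ Finset.range d, (blockCount d t i : ℝ) = t := by
  have := sum_Icc_eq_sum_blocks hd t (fun _ => (1 : ℝ))
  simpa using this.symm

/-- Jensen's inequality for the logarithm over the blocks. -/
lemma sum_log_blockCount_le {d : ℕ} (hd : 1 ≤ d) (t : ℕ) {a : ℝ} (ha : 0 ≤ a) :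
    ∑ i ∈ Finset.range d, Real.log (1 + a * blockCount d t i) ≤ d * Real.log (1 + a * t / d) := by
  have hd0 : (0 : ℝ) < d := by exact_mod_cast hd
  set y : ℝ := 1 + a * t / d with hy
  have hy0 : 0 < y := by positivity
  -- Tangent line of the logarithm at the average `y`; the linear corrections sum to zero.
  have h : ∀ i ∈ Finset.range d, Real.log (1 + a * blockCount d t i) ≤
      Real.log y + ((1 + a * blockCount d t i) / y - 1) := by
    intro i _
    have h1 : 0 < 1 + a * (blockCount d t i : ℝ) := by positivity
    have := Real.log_le_sub_one_of_pos (div_pos h1 hy0)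
    rw [Real.log_div h1.ne' hy0.ne'] at this
    linarith
  refine (Finset.sum_le_sum h).trans (le_of_eq ?_)
  rw [Finset.sum_add_distrib, Finset.sum_sub_distrib, ← Finset.sum_div, Finset.sum_add_distrib,
    ← Finset.mul_sum, sum_blockCount hd]
  have : ((d : ℝ) + a * t) / y = d := by
    rw [div_eq_iff hy0.ne', hy]; field_simp
  simp [this]

end Blocks

/-! ### From block bounds to the noise radius. -/

section Confidence

/-- The noise part of half the squared confidence radius. -/
noncomputable def noiseRadius (p d : ℕ) (B δ : ℝ) (t : ℕ) : ℝ :=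
  d * p / 2 * Real.log ((B + 1) ^ 2 * Real.exp 1 * max ((d : ℝ) * p) (t + d) / (d * p))
    + d * Real.log (d / δ)

/-- The summand 1 pays for the prior penalty `ρ/2 ‖θ‖² ≤ p/2` incurred in each block. -/
lemma one_add_log_le_log {p d : ℕ} (hp : 1 ≤ p) (hd : 1 ≤ d) {B : ℝ} (hB : 0 < B) (t : ℕ) :
    1 + Real.log (1 + B ^ 2 * t / (d * p)) ≤
      Real.log ((B + 1) ^ 2 * Real.exp 1 * max ((d : ℝ) * p) (t + d) / (d * p)) := by
  have hp0 : (1 : ℝ) ≤ p := by exact_mod_cast hp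
  have hd0 : (1 : ℝ) ≤ d := by exact_mod_cast hd
  have hdp : (0 : ℝ) < d * p := by positivity
  have hlog : 1 + Real.log (1 + B ^ 2 * t / (d * p)) =
      Real.log (Real.exp 1 * (1 + B ^ 2 * t / (d * p))) := by
    rw [Real.log_mul (by positivity) (by positivity), Real.log_exp]
  rw [hlog]
  refine Real.log_le_log (by positivity) ?_
  rw [le_div_iff₀ hdp]
  have h1 : (1 + B ^ 2 * t / (d * p)) * (d * p) = d * p + B ^ 2 * t := by field_simp
  have h2 : (d : ℝ) * p ≤ max ((d : ℝ) * p) (t + d) := le_max_left _ _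
  have h3 : (t : ℝ) ≤ max ((d : ℝ) * p) (t + d) := le_trans (by linarith) (le_max_right _ _)
  have h4 : (d : ℝ) * p + B ^ 2 * t ≤ (B + 1) ^ 2 * max ((d : ℝ) * p) (t + d) := by
    have : B ^ 2 * (t : ℝ) ≤ B ^ 2 * max ((d : ℝ) * p) (t + d) := by gcongr
    nlinarith
  calc _ = Real.exp 1 * ((1 + B ^ 2 * t / (d * p)) * (d * p)) := by ring
    _ ≤ Real.exp 1 * ((B + 1) ^ 2 * max ((d : ℝ) * p) (t + d)) := by rw [h1]; gcongr
    _ = _ := by ring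

/-- The event that, in one of the blocks, some likelihood ratio is atypically large. -/
def badEvent {Ω : Type*} {mΩ : MeasurableSpace Ω} (μ : Measure Ω) {p : ℕ} (d : ℕ) (B δ : ℝ)
    (ε : ℕ → Ω → ℝ) (θs : Vec p) (X : ℕ → Ω → Vec p) : Set Ω :=
  ⋃ i ∈ Finset.range d, {ω | ∃ (n : ℕ) (θ : Vec p),
    p / B ^ 2 / 2 * ‖θ‖ ^ 2 + p / 2 * Real.log (1 + n / (p / B ^ 2 * p)) + Real.log (1 / (δ / d)) <
      logRatio θs (fun j => X (i + 1 + j * d) ω)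
        (fun j => centredNoise μ ε d (i + 1 + j * d) ω) n θ}

variable {Ω : Type*} {mΩ : MeasurableSpace Ω} {μ : Measure Ω} {p d : ℕ} {B δ : ℝ} {φ : ℕ → ℝ}
  {ε : ℕ → Ω → ℝ} {θs : Vec p} {X : ℕ → Ω → Vec p}

lemma measure_badEvent_le [IsProbabilityMeasure μ] (hp : 1 ≤ p) (hd : 1 ≤ d) (hB : 0 < B)
    (hδ : 0 < δ) (hε : IsMixingSubGaussian μ ε 1 φ)
    (hX : ∀ t, 1 ≤ t → Measurable[noiseSigma ε (t - d)] (X t))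
    (hX1 : ∀ t, 1 ≤ t → ∀ ω, ‖X t ω‖ ≤ 1) :
    μ (badEvent μ d B δ ε θs X) ≤ ENNReal.ofReal δ := by
  have hd0 : (0 : ℝ) < d := by exact_mod_cast hd
  have hp0 : (0 : ℝ) < p := by exact_mod_cast hp
  refine (measure_biUnion_finset_le _ _).trans ?_
  have h : ∀ i ∈ Finset.range d, μ {ω | ∃ (n : ℕ) (θ : Vec p),
      p / B ^ 2 / 2 * ‖θ‖ ^ 2 + p / 2 * Real.log (1 + n / (p / B ^ 2 * p))
        + Real.log (1 / (δ / d)) <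
      logRatio θs (fun j => X (i + 1 + j * d) ω)
        (fun j => centredNoise μ ε d (i + 1 + j * d) ω) n θ} ≤ ENNReal.ofReal (δ / d) := by
    intro i hi
    have hi := Finset.mem_range.1 hi
    -- Stage `n` of block `i` carries the information available `d` rounds before its round `i + 1 +
    -- n * d`. Stage `n + 1` then knows the noise of that round. For `n = 0` truncation gives the
    -- trivial σ-algebra, since `i + 1 ≤ d`.
    refine measure_logRatio_le (G := fun n => noiseSigma ε (i + 1 + n * d - d)) hp
      (fun n => noiseSigma_le hε.measurable _) ?_ θs (by positivity) (fun n => hX _ (by omega))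
      ?_ (fun n => condSubgaussian_centredNoise hε hd (by omega)) (fun n => hX1 _ (by omega))
      (by positivity)
    · intro a b hab
      refine noiseSigma_mono ?_
      have := Nat.mul_le_mul_right d hab
      omega
    · intro n
      have e : i + 1 + (n + 1) * d - d = i + 1 + n * d := by rw [Nat.succ_mul]; omega
      change Measurable[noiseSigma ε (i + 1 + (n + 1) * d - d)] _
      rw [e]
      exact measurable_centredNoise (by omega)
  refine (Finset.sum_le_sum h).trans (le_of_eq ?_)
  rw [Finset.sum_const, Finset.card_range, nsmul_eq_mul, ← ENNReal.ofReal_natCast,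
    ← ENNReal.ofReal_mul hd0.le]
  congr 1
  field_simp

lemma sum_logRatio_le (hp : 1 ≤ p) (hd : 1 ≤ d) (hB : 0 < B) {ω : Ω}
    (hω : ω ∉ badEvent μ d B δ ε θs X) (t : ℕ) {θ : Vec p} (hθ : ‖θ‖ ≤ B) :
    ∑ s ∈ Finset.Icc 1 t, (inner ℝ (θ - θs) (X s ω) * centredNoise μ ε d s ω
      - inner ℝ (θ - θs) (X s ω) ^ 2 / 2) ≤ noiseRadius p d B δ t := by
  have hp0 : (1 : ℝ) ≤ p := by exact_mod_cast hp
  have hd0 : (1 : ℝ) ≤ d := by exact_mod_cast hd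
  simp only [badEvent, Set.mem_iUnion, Set.mem_ofPred_eq, not_exists, not_lt,
    Finset.mem_range] at hω
  rw [sum_Icc_eq_sum_blocks hd]
  have hb : ∀ i ∈ Finset.range d, ∑ n ∈ Finset.range (blockCount d t i),
      (inner ℝ (θ - θs) (X (i + 1 + n * d) ω) * centredNoise μ ε d (i + 1 + n * d) ω
        - inner ℝ (θ - θs) (X (i + 1 + n * d) ω) ^ 2 / 2) ≤
      p / 2 + p / 2 * Real.log (1 + B ^ 2 / p * blockCount d t i) + Real.log (d / δ) := by
    intro i hi
    refine (hω i (Finset.mem_range.1 hi) (blockCount d t i) θ).trans ?_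
    -- The prior precision `p / B²` is chosen so that this penalty is at most `p/2` on the ball.
    have h1 : p / B ^ 2 / 2 * ‖θ‖ ^ 2 ≤ (p : ℝ) / 2 := by
      calc _ ≤ (p : ℝ) / B ^ 2 / 2 * B ^ 2 := by gcongr
        _ = _ := by field_simp
    have h2 : (blockCount d t i : ℝ) / (p / B ^ 2 * p) ≤ B ^ 2 / p * blockCount d t i := by
      have : (blockCount d t i : ℝ) / (p / B ^ 2 * p) = B ^ 2 / p * blockCount d t i * (1 / p) := by
        field_simp
      rw [this]
      refine mul_le_of_le_one_right (by positivity) ?_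
      rw [div_le_one (by positivity)]
      exact hp0
    have h3 : Real.log (1 + (blockCount d t i : ℝ) / (p / B ^ 2 * p)) ≤
        Real.log (1 + B ^ 2 / p * blockCount d t i) :=
      Real.log_le_log (by positivity) (by linarith)
    have h4 : (p : ℝ) / 2 * Real.log (1 + (blockCount d t i : ℝ) / (p / B ^ 2 * p)) ≤
        p / 2 * Real.log (1 + B ^ 2 / p * blockCount d t i) := by gcongr
    rw [one_div_div]
    linarith
  refine (Finset.sum_le_sum hb).trans ?_
  rw [Finset.sum_add_distrib, Finset.sum_add_distrib, ← Finset.mul_sum]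
  have h1 := sum_log_blockCount_le hd t (a := B ^ 2 / p) (by positivity)
  have e : B ^ 2 / p * t / d = B ^ 2 * t / (d * p) := by field_simp
  rw [e] at h1
  have h2 := one_add_log_le_log hp hd hB t
  simp only [Finset.sum_const, Finset.card_range, nsmul_eq_mul]
  have h3 : (p : ℝ) / 2 * ∑ i ∈ Finset.range d, Real.log (1 + B ^ 2 / p * blockCount d t i) ≤
      p / 2 * (d * Real.log (1 + B ^ 2 * t / (d * p))) := by gcongr
  have h4 : (d : ℝ) * p / 2 * (1 + Real.log (1 + B ^ 2 * t / (d * p))) ≤ d * p / 2 *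
      Real.log ((B + 1) ^ 2 * Real.exp 1 * max ((d : ℝ) * p) (t + d) / (d * p)) := by gcongr
  rw [noiseRadius]
  linarith

end Confidence

/-! ### Elliptical potentials, one per block. -/

section EllipticalPotential

open Matrix

variable {p : ℕ} {lam : ℝ}

lemma dotProduct_ofLp (u v : Vec p) : u.ofLp ⬝ᵥ v.ofLp = inner ℝ u v := by
  rw [EuclideanSpace.inner_eq_star_dotProduct, dotProduct_comm]
  simp

lemma sum_Icc_one_eq_sum_range {M : Type*} [AddCommMonoid M] (f : ℕ → M) (t : ℕ) :
    ∑ s ∈ Finset.Icc 1 t, f s = ∑ j ∈ Finset.range t, f (j + 1) := by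
  induction t with
  | zero => simp
  | succ t ih => rw [Finset.sum_Icc_succ_top (by omega), ih, Finset.sum_range_succ]

lemma featureCov_quadForm (x : ℕ → Vec p) (t : ℕ) (u : Vec p) :
    u.ofLp ⬝ᵥ (featureCov lam x t).mulVec u.ofLp =
      ∑ s ∈ Finset.Icc 1 t, inner ℝ u (x s) ^ 2 + lam * ‖u‖ ^ 2 := by
  rw [featureCov, add_mulVec, dotProduct_add, sum_mulVec, dotProduct_sum, smul_mulVec, one_mulVec,
    dotProduct_smul, dotProduct_ofLp, real_inner_self_eq_norm_sq, smul_eq_mul]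
  congr 1
  refine Finset.sum_congr rfl fun s _ => ?_
  rw [vecMulVec_mulVec, op_smul_eq_smul, dotProduct_smul, dotProduct_ofLp, dotProduct_ofLp,
    real_inner_comm, smul_eq_mul, sq]

lemma featureCov_zero (x : ℕ → Vec p) : featureCov lam x 0 = lam • 1 := by
  simp [featureCov]

lemma featureCov_succ (x : ℕ → Vec p) (t : ℕ) :
    featureCov lam x (t + 1) =
      featureCov lam x t + vecMulVec (x (t + 1)).ofLp (x (t + 1)).ofLp := by
  rw [featureCov, featureCov, Finset.sum_Icc_succ_top (by omega)]
  abel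

lemma featureCov_posDef (hlam : 0 < lam) (x : ℕ → Vec p) (t : ℕ) :
    (featureCov lam x t).PosDef := by
  refine PosDef.of_dotProduct_mulVec_pos ?_ fun u hu => ?_
  · induction t with
    | zero => rw [featureCov_zero]; simp [IsHermitian]
    | succ t ih =>
      rw [featureCov_succ]
      refine ih.add ?_
      simp [IsHermitian]
  · have h := featureCov_quadForm (lam := lam) x t (WithLp.toLp 2 u)
    simp only [star_trivial]
    rw [show u ⬝ᵥ (featureCov lam x t).mulVec u = _ from h]
    have hne : WithLp.toLp 2 u ≠ 0 := by simpa using hu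
    have : 0 < ‖WithLp.toLp 2 u‖ := norm_pos_iff.2 hne
    have : 0 ≤ ∑ s ∈ Finset.Icc 1 t, inner ℝ (WithLp.toLp 2 u) (x s) ^ 2 :=
      Finset.sum_nonneg fun _ _ => sq_nonneg _
    positivity

lemma weightedNorm_sq (hlam : 0 < lam) (x : ℕ → Vec p) (t : ℕ) (u : Vec p) :
    weightedNorm (featureCov lam x t) u ^ 2 =
      ∑ s ∈ Finset.Icc 1 t, inner ℝ u (x s) ^ 2 + lam * ‖u‖ ^ 2 := by
  rw [weightedNorm, featureCov_quadForm, Real.sq_sqrt]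
  have : 0 ≤ ∑ s ∈ Finset.Icc 1 t, inner ℝ u (x s) ^ 2 :=
    Finset.sum_nonneg fun _ _ => sq_nonneg _
  positivity

/-- The **Cauchy–Schwarz inequality** for the dual norms of a positive definite matrix. -/
lemma dotProduct_sq_le_of_posDef {A : Matrix (Fin p) (Fin p) ℝ} (hA : A.PosDef)
    (x w : Fin p → ℝ) : (x ⬝ᵥ w) ^ 2 ≤ (x ⬝ᵥ A⁻¹.mulVec x) * (w ⬝ᵥ A.mulVec w) := by
  set y := A⁻¹.mulVec x with hy
  have hdet : IsUnit A.det := hA.det_pos.ne'.isUnit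
  have hxy : A.mulVec y = x := by
    rw [hy, mulVec_mulVec, mul_nonsing_inv _ hdet, one_mulVec]
  have hsymm : ∀ a b : Fin p → ℝ, a ⬝ᵥ A.mulVec b = b ⬝ᵥ A.mulVec a := by
    intro a b
    have hT : Aᵀ = A := by simpa [IsHermitian] using hA.isHermitian
    rw [dotProduct_mulVec, ← mulVec_transpose, hT, dotProduct_comm]
  -- The form at `A⁻¹x + c w` is nonnegative for every `c`, so its discriminant is nonpositive.
  have hnn : ∀ c : ℝ, 0 ≤ (w ⬝ᵥ A.mulVec w) * (c * c) + (2 * (x ⬝ᵥ w)) * c + x ⬝ᵥ y := by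
    intro c
    have h := hA.posSemidef.dotProduct_mulVec_nonneg (y + c • w)
    simp only [star_trivial] at h
    rw [mulVec_add, mulVec_smul, hxy, dotProduct_add, dotProduct_smul, add_dotProduct,
      add_dotProduct, smul_dotProduct, smul_dotProduct, hsymm y w, hxy] at h
    simp only [smul_eq_mul] at h
    rw [dotProduct_comm w x, dotProduct_comm y x] at h
    linarith
  have := discrim_le_zero hnn
  rw [discrim] at this
  nlinarith

/-- AM–GM for the eigenvalues, again by the tangent line of the logarithm at their mean. -/
lemma log_det_le_of_posDef (hp : 1 ≤ p) {A : Matrix (Fin p) (Fin p) ℝ} (hA : A.PosDef) :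
    Real.log A.det ≤ p * Real.log (A.trace / p) := by
  have hp0 : (0 : ℝ) < p := by exact_mod_cast hp
  have : Nonempty (Fin p) := ⟨⟨0, hp⟩⟩
  have hpos := hA.eigenvalues_pos
  have htr : A.trace = ∑ i, hA.isHermitian.eigenvalues i := by
    simpa using hA.isHermitian.trace_eq_sum_eigenvalues
  have hdet : A.det = ∏ i, hA.isHermitian.eigenvalues i := by
    simpa using hA.isHermitian.det_eq_prod_eigenvalues
  have htr0 : 0 < A.trace := htr ▸ Finset.sum_pos (fun i _ => hpos i) Finset.univ_nonempty
  set y := A.trace / p with hy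
  have hy0 : 0 < y := by positivity
  rw [hdet, Real.log_prod fun i _ => (hpos i).ne']
  have h : ∀ i ∈ Finset.univ, Real.log (hA.isHermitian.eigenvalues i) ≤
      Real.log y + (hA.isHermitian.eigenvalues i / y - 1) := by
    intro i _
    have := Real.log_le_sub_one_of_pos (div_pos (hpos i) hy0)
    rw [Real.log_div (hpos i).ne' hy0.ne'] at this
    linarith
  refine (Finset.sum_le_sum h).trans (le_of_eq ?_)
  rw [Finset.sum_add_distrib, Finset.sum_sub_distrib, ← Finset.sum_div, ← htr]
  have : A.trace / y = p := by rw [div_eq_iff hy0.ne', hy]; field_simp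
  simp [this]

lemma featureCov_det_succ (hlam : 0 < lam) (x : ℕ → Vec p) (t : ℕ) :
    (featureCov lam x (t + 1)).det = (featureCov lam x t).det *
      (1 + (x (t + 1)).ofLp ⬝ᵥ (featureCov lam x t)⁻¹.mulVec (x (t + 1)).ofLp) := by
  have hdet : IsUnit (featureCov lam x t).det := (featureCov_posDef hlam x t).det_pos.ne'.isUnit
  rw [featureCov_succ, vecMulVec_eq Unit, det_add_replicateCol_mul_replicateRow hdet]
  congr 1
  rw [det_unique, Matrix.add_apply, Matrix.one_apply_eq, Matrix.mul_assoc]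
  rfl

lemma inv_quadForm_nonneg (hlam : 0 < lam) (x : ℕ → Vec p) (t : ℕ) (u : Vec p) :
    0 ≤ u.ofLp ⬝ᵥ (featureCov lam x t)⁻¹.mulVec u.ofLp := by
  simpa using (featureCov_posDef hlam x t).inv.posSemidef.dotProduct_mulVec_nonneg u.ofLp

/-- The **elliptical potential lemma**. -/
lemma sum_log_potential_le (hp : 1 ≤ p) (hlam : 0 < lam) (x : ℕ → Vec p) (N : ℕ)
    (hx : ∀ s, 1 ≤ s → ‖x s‖ ≤ 1) :
    ∑ n ∈ Finset.range N, Real.log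
        (1 + (x (n + 1)).ofLp ⬝ᵥ (featureCov lam x n)⁻¹.mulVec (x (n + 1)).ofLp) ≤
      p * Real.log (1 + N / (lam * p)) := by
  have hp0 : (0 : ℝ) < p := by exact_mod_cast hp
  -- By the determinant formula for a rank-one update the sum telescopes.
  have hsum : ∑ n ∈ Finset.range N, Real.log
        (1 + (x (n + 1)).ofLp ⬝ᵥ (featureCov lam x n)⁻¹.mulVec (x (n + 1)).ofLp) =
      Real.log (featureCov lam x N).det - p * Real.log lam := by
    induction N with
    | zero => simp [featureCov_zero, Real.log_pow]
    | succ N ih =>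
      have h1 := (featureCov_posDef hlam x N).det_pos
      have h2 := inv_quadForm_nonneg hlam x N (x (N + 1))
      rw [Finset.sum_range_succ, ih, featureCov_det_succ hlam, Real.log_mul h1.ne' (by positivity)]
      ring
  have htr : (featureCov lam x N).trace ≤ N + lam * p := by
    rw [featureCov, trace_add, trace_sum, trace_smul, trace_one, Fintype.card_fin, smul_eq_mul]
    gcongr
    calc _ ≤ ∑ s ∈ Finset.Icc 1 N, (1 : ℝ) := by
          refine Finset.sum_le_sum fun s hs => ?_
          rw [trace_vecMulVec, dotProduct_ofLp, real_inner_self_eq_norm_sq]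
          exact pow_le_one₀ (norm_nonneg _) (hx s (Finset.mem_Icc.1 hs).1)
      _ = N := by simp
  have : Nonempty (Fin p) := ⟨⟨0, hp⟩⟩
  have htr0 : 0 < (featureCov lam x N).trace := (featureCov_posDef hlam x N).trace_pos
  have h1 := log_det_le_of_posDef hp (featureCov_posDef hlam x N)
  have h2 : Real.log ((featureCov lam x N).trace / p) ≤
      Real.log lam + Real.log (1 + N / (lam * p)) := by
    rw [← Real.log_mul hlam.ne' (by positivity)]
    refine Real.log_le_log (by positivity) ?_
    rw [div_le_iff₀ hp0]
    refine htr.trans (le_of_eq ?_)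
    field_simp
    ring
  rw [hsum]
  nlinarith [mul_le_mul_of_nonneg_left h2 hp0.le]

/-- The constant 3/2, sharper than the customary 2, leaves room in the final budget for the rounds
where the confidence set misses `θ⋆`. -/
lemma min_one_le_log {y : ℝ} (hy : 0 ≤ y) : min 1 y ≤ 3 / 2 * Real.log (1 + y) := by
  rcases le_total y 1 with h | h
  · have h1 := Real.le_log_one_add_of_nonneg hy
    have h2 : y ≤ 3 / 2 * (2 * y / (y + 2)) := by
      rw [mul_div_assoc', le_div_iff₀ (by positivity)]
      nlinarith
    rw [min_eq_right h]
    linarith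
  · rw [min_eq_left h]
    have h1 : Real.log 2 ≤ Real.log (1 + y) := Real.log_le_log (by norm_num) (by linarith)
    have := Real.log_two_gt_d9
    linarith

/-- The features of the block of round `t`, that is, of the rounds congruent to `t` modulo `d`. -/
def blockFeature (x : ℕ → Vec p) (d i : ℕ) (k : ℕ) : Vec p := x (i + 1 + (k - 1) * d)

/-- The squared norm of `x t` dual to the feature covariance of the previous rounds in its block. -/
noncomputable def blockPotential (lam : ℝ) (x : ℕ → Vec p) (d t : ℕ) : ℝ :=
  (x t).ofLp ⬝ᵥ
    (featureCov lam (blockFeature x d ((t - 1) % d)) ((t - 1) / d))⁻¹.mulVec (x t).ofLp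

lemma blockPotential_nonneg (hlam : 0 < lam) (x : ℕ → Vec p) (d t : ℕ) :
    0 ≤ blockPotential lam x d t :=
  inv_quadForm_nonneg hlam _ _ _

lemma sum_blockPotential_le (hp : 1 ≤ p) (hlam : 0 < lam) (x : ℕ → Vec p) {d : ℕ} (hd : 1 ≤ d)
    (hx : ∀ s, 1 ≤ s → ‖x s‖ ≤ 1) (T : ℕ) :
    ∑ t ∈ Finset.Icc 1 T, min 1 (blockPotential lam x d t) ≤
      3 / 2 * (d * p * Real.log (1 + T / (lam * (d * p)))) := by
  have hp0 : (0 : ℝ) < p := by exact_mod_cast hp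
  have hd0 : (0 : ℝ) < d := by exact_mod_cast hd
  calc _ ≤ ∑ t ∈ Finset.Icc 1 T, 3 / 2 * Real.log (1 + blockPotential lam x d t) :=
        Finset.sum_le_sum fun t _ => min_one_le_log (blockPotential_nonneg hlam _ _ _)
    _ = 3 / 2 * ∑ i ∈ Finset.range d, ∑ n ∈ Finset.range (blockCount d T i),
          Real.log (1 + blockPotential lam x d (i + 1 + n * d)) := by
        rw [← Finset.mul_sum, sum_Icc_eq_sum_blocks hd]
    _ ≤ 3 / 2 * ∑ i ∈ Finset.range d, p * Real.log (1 + 1 / (lam * p) * blockCount d T i) := by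
        gcongr with i hi
        have hi := Finset.mem_range.1 hi
        refine le_trans (le_of_eq ?_) ((sum_log_potential_le hp hlam (blockFeature x d i)
          (blockCount d T i) fun s _ => hx _ (by omega)).trans (le_of_eq ?_))
        · refine Finset.sum_congr rfl fun n _ => ?_
          have e : i + 1 + n * d - 1 = i + n * d := by omega
          simp only [blockPotential, blockFeature, e, Nat.add_mul_mod_self_right,
            Nat.mod_eq_of_lt hi, Nat.add_mul_div_right _ _ hd, Nat.div_eq_of_lt hi, zero_add,
            Nat.add_sub_cancel]
        · rw [div_eq_inv_mul, one_div]
    _ ≤ 3 / 2 * (p * (d * Real.log (1 + 1 / (lam * p) * T / d))) := by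
        rw [← Finset.mul_sum]
        gcongr
        exact sum_log_blockCount_le hd T (by positivity)
    _ = _ := by
        have e : 1 / (lam * p) * T / d = T / (lam * (d * p)) := by field_simp
        rw [e]; ring

/-- The block potential controls the action of `x t` on the weighted norm with delay `d`. -/
lemma inner_sq_le_blockPotential_mul (hlam : 0 < lam) (x : ℕ → Vec p) {d t : ℕ} (hd : 1 ≤ d)
    (ht : d < t) (w : Vec p) :
    inner ℝ (x t) w ^ 2 ≤
      blockPotential lam x d t * weightedNorm (featureCov lam x (t - d)) w ^ 2 := by
  set i := (t - 1) % d with hi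
  set n := (t - 1) / d with hn
  have hid : i < d := Nat.mod_lt _ hd
  have htin : i + n * d = t - 1 := Nat.mod_add_div' (t - 1) d
  have h1 := dotProduct_sq_le_of_posDef (featureCov_posDef hlam (blockFeature x d i) n)
    (x t).ofLp w.ofLp
  rw [dotProduct_ofLp, featureCov_quadForm] at h1
  refine h1.trans (mul_le_mul_of_nonneg_left ?_ (blockPotential_nonneg hlam x d t))
  rw [weightedNorm_sq hlam]
  gcongr
  -- The earlier rounds in the block of `t` are exactly its rounds up to `t - d`, so they all enter
  -- `V_{t-d}`.
  have hcount : blockCount d (t - d) i = n := by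
    refine eq_of_forall_lt_iff fun m => ?_
    rw [lt_blockCount_iff hid]
    have key : m < n ↔ (m + 1) * d ≤ n * d := by
      rw [Nat.mul_le_mul_right_iff (by omega)]; omega
    rw [key, Nat.succ_mul]
    omega
  rw [sum_Icc_one_eq_sum_range (fun s => inner ℝ w (blockFeature x d i s) ^ 2),
    sum_Icc_eq_sum_blocks hd]
  refine le_trans (le_of_eq ?_) (Finset.single_le_sum (f := fun i => ∑ n ∈ Finset.range
    (blockCount d (t - d) i), inner ℝ w (x (i + 1 + n * d)) ^ 2)
    (fun i _ => Finset.sum_nonneg fun _ _ => sq_nonneg _) (Finset.mem_range.2 hid))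
  simp only [hcount, blockFeature, Nat.add_sub_cancel]

end EllipticalPotential

/-! ### Least squares, confidence sets and optimism. -/

section Regret

variable {p d : ℕ} {B lam δ : ℝ} {φ : ℕ → ℝ} {θs : Vec p}

/-- First-order optimality of the constrained least-squares estimator. -/
lemma IsLeastSquares.sum_sq_le {x : ℕ → Vec p} {y e : ℕ → ℝ} {t : ℕ} {θ : Vec p}
    (h : IsLeastSquares B x y t θ) (hθs : θs ∈ Metric.closedBall (0 : Vec p) B)
    (hy : ∀ s, y s = inner ℝ θs (x s) + e s) :
    ∑ s ∈ Finset.Icc 1 t, inner ℝ (θ - θs) (x s) ^ 2 ≤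
      ∑ s ∈ Finset.Icc 1 t, inner ℝ (θ - θs) (x s) * e s := by
  set v : ℕ → ℝ := fun s => inner ℝ (θ - θs) (x s) with hv
  set S := ∑ s ∈ Finset.Icc 1 t, v s ^ 2 with hS
  set R := ∑ s ∈ Finset.Icc 1 t, v s * e s with hR
  -- Move from `θ` towards `θs` by a fraction `c`, staying in the convex ball; small `c` will force
  -- `S ≤ R`.
  have key : ∀ c : ℝ, 0 < c → c ≤ 1 → S - R ≤ c * (S / 2) := by
    intro c hc0 hc1
    have hmem : θ + c • (θs - θ) ∈ Metric.closedBall (0 : Vec p) B :=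
      (convex_closedBall _ _).add_smul_sub_mem h.1 hθs ⟨hc0.le, hc1⟩
    have hmin : ∑ s ∈ Finset.Icc 1 t, (inner ℝ θ (x s) - y s) ^ 2 ≤
        ∑ s ∈ Finset.Icc 1 t, (inner ℝ (θ + c • (θs - θ)) (x s) - y s) ^ 2 := h.2 hmem
    have e1 : ∑ s ∈ Finset.Icc 1 t, (inner ℝ (θ + c • (θs - θ)) (x s) - y s) ^ 2 =
        ∑ s ∈ Finset.Icc 1 t, (inner ℝ θ (x s) - y s) ^ 2 - 2 * c * (S - R) + c ^ 2 * S := by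
      rw [hS, hR, ← Finset.sum_sub_distrib, Finset.mul_sum, Finset.mul_sum,
        ← Finset.sum_sub_distrib, ← Finset.sum_add_distrib]
      refine Finset.sum_congr rfl fun s _ => ?_
      simp only [hv, hy, inner_add_left, inner_sub_left, inner_smul_left, RCLike.conj_to_real]
      ring
    rw [e1] at hmin
    have : c * (2 * (S - R)) ≤ c * (c * S) := by nlinarith
    have := le_of_mul_le_mul_left this hc0
    linarith
  have hS0 : 0 ≤ S := Finset.sum_nonneg fun _ _ => sq_nonneg _
  by_contra hlt
  push Not at hlt
  have hpos : 0 < S - R := by linarith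
  have h1 := key (min 1 ((S - R) / (S + 1))) (lt_min one_pos (by positivity)) (min_le_left _ _)
  have h2 : min 1 ((S - R) / (S + 1)) * (S / 2) ≤ (S - R) / (S + 1) * (S / 2) :=
    mul_le_mul_of_nonneg_right (min_le_right _ _) (by positivity)
  have h3 : (S - R) / (S + 1) * (S / 2) = (S - R) * (S / (2 * (S + 1))) := by
    field_simp
  have h4 : S / (2 * (S + 1)) ≤ 1 / 2 := by
    rw [div_le_div_iff₀ (by positivity) (by positivity)]; linarith
  nlinarith [mul_le_mul_of_nonneg_left h4 hpos.le]

lemma sum_abs_sq_le (v : ℕ → ℝ) (t : ℕ) :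
    (∑ s ∈ Finset.Icc 1 t, |v s|) ^ 2 ≤ t * ∑ s ∈ Finset.Icc 1 t, v s ^ 2 := by
  have := sq_sum_le_card_mul_sum_sq (s := Finset.Icc 1 t) (f := fun s => |v s|)
  simpa [sq_abs] using this

/-- Either the confidence set contains the true parameter, or the round is so early that the noise
radius is of larger order than the round. -/
lemma mem_confSet_or (hB : 0 < B) (hlam : 0 < lam) {x : ℕ → Vec p} {y e z : ℕ → ℝ} {t : ℕ}
    {θ : Vec p} (hθs : θs ∈ Metric.closedBall (0 : Vec p) B) (h : IsLeastSquares B x y t θ)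
    (hy : ∀ s, y s = inner ℝ θs (x s) + e s) (hez : ∀ s, 1 ≤ s → |e s - z s| ≤ φ d)
    (hz : ∑ s ∈ Finset.Icc 1 t, (inner ℝ (θ - θs) (x s) * z s - inner ℝ (θ - θs) (x s) ^ 2 / 2) ≤
      noiseRadius p d B δ t)
    (hφ0 : 0 ≤ φ d) (hφ : φ d ≤ (B + 1) / 12) :
    θs ∈ confSet d B lam δ φ x θ t ∨ 5 / 12 * (B + 1) ^ 2 * t ≤ noiseRadius p d B δ t := by
  have hls := h.sum_sq_le hθs hy
  set v : ℕ → ℝ := fun s => inner ℝ (θ - θs) (x s) with hv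
  set S := ∑ s ∈ Finset.Icc 1 t, v s ^ 2 with hS
  set A := ∑ s ∈ Finset.Icc 1 t, |v s| with hA
  have hS0 : 0 ≤ S := Finset.sum_nonneg fun _ _ => sq_nonneg _
  have hA0 : 0 ≤ A := Finset.sum_nonneg fun _ _ => abs_nonneg _
  have hAS : A ^ 2 ≤ t * S := sum_abs_sq_le v t
  have h1 : ∑ s ∈ Finset.Icc 1 t, v s * e s ≤ φ d * A + ∑ s ∈ Finset.Icc 1 t, v s * z s := by
    rw [hA, Finset.mul_sum, ← Finset.sum_add_distrib]
    refine Finset.sum_le_sum fun s hs => ?_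
    have h2 : v s * (e s - z s) ≤ |v s| * φ d :=
      (le_abs_self _).trans (by
        rw [abs_mul]
        exact mul_le_mul_of_nonneg_left (hez s (Finset.mem_Icc.1 hs).1) (abs_nonneg _))
    linarith
  rw [Finset.sum_sub_distrib, ← Finset.sum_div] at hz
  have h2 : S / 2 ≤ φ d * A + noiseRadius p d B δ t := by linarith
  -- If the root mean square of `v` is at most `B + 1`, Cauchy–Schwarz gives the bias `t φ_d (B +
  -- 1)` allowed by the radius. Otherwise `(B + 1) A ≤ S`, the bias is at most `S/12`, and `S/2 -
  -- S/12 = 5S/12` is bounded by the noise radius.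
  rcases le_or_gt S ((B + 1) ^ 2 * t) with hle | hgt
  · left
    refine ⟨hθs, ?_⟩
    have hA1 : A ≤ (B + 1) * t := by
      refine abs_le_of_sq_le_sq' ?_ (by positivity) |>.2
      calc A ^ 2 ≤ t * S := hAS
        _ ≤ t * ((B + 1) ^ 2 * t) := by gcongr
        _ = _ := by ring
    have hnorm : ‖θs - θ‖ ≤ 2 * B := by
      have h3 := mem_closedBall_zero_iff.1 hθs
      have h4 := mem_closedBall_zero_iff.1 h.1
      linarith [norm_sub_le θs θ]
    have hsq : lam * ‖θs - θ‖ ^ 2 ≤ lam * (2 * B) ^ 2 := by gcongr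
    have hsum : ∑ s ∈ Finset.Icc 1 t, inner ℝ (θs - θ) (x s) ^ 2 = S := by
      refine Finset.sum_congr rfl fun s _ => ?_
      rw [← neg_sub θ θs, inner_neg_left, neg_sq]
    rw [weightedNorm_sq hlam, hsum]
    have h5 : φ d * A ≤ φ d * ((B + 1) * t) := by gcongr
    rw [noiseRadius] at h2
    linarith
  · right
    have hA1 : (B + 1) * A ≤ S := by
      refine abs_le_of_sq_le_sq' ?_ hS0 |>.2
      calc ((B + 1) * A) ^ 2 = (B + 1) ^ 2 * A ^ 2 := by ring
        _ ≤ (B + 1) ^ 2 * (t * S) := by gcongr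
        _ = ((B + 1) ^ 2 * t) * S := by ring
        _ ≤ S * S := by gcongr
        _ = S ^ 2 := by ring
    have h5 : φ d * A ≤ (B + 1) / 12 * A := by gcongr
    linarith

lemma radiusSq_eq (t : ℕ) : radiusSq p d B lam δ φ t =
    2 * noiseRadius p d B δ t + 4 * lam * B ^ 2 + 2 * t * φ d * (B + 1) := by
  rw [radiusSq, noiseRadius]; ring

lemma noiseRadius_nonneg (hp : 1 ≤ p) (hd : 1 ≤ d) (hB : 0 < B) (hδ : δ ∈ Set.Ioo (0 : ℝ) 1)
    (t : ℕ) : 0 ≤ noiseRadius p d B δ t := by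
  have h1 := one_add_log_le_log hp hd hB t
  have h2 : 0 ≤ Real.log (1 + B ^ 2 * t / (d * p)) := Real.log_nonneg (by
    have : 0 ≤ B ^ 2 * t / (d * p) := by positivity
    linarith)
  have hd0 : (1 : ℝ) ≤ d := by exact_mod_cast hd
  have h3 : 0 ≤ Real.log (d / δ) := Real.log_nonneg (by
    rw [le_div_iff₀ hδ.1]; linarith [hδ.2])
  have h4 : 0 ≤ Real.log ((B + 1) ^ 2 * Real.exp 1 * max ((d : ℝ) * p) (t + d) / (d * p)) := by
    linarith
  rw [noiseRadius]
  positivity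

lemma noiseRadius_mono (hp : 1 ≤ p) (hd : 1 ≤ d) (hB : 0 < B) :
    Monotone (noiseRadius p d B δ) := by
  intro s t hst
  have hp0 : (0 : ℝ) < p := by exact_mod_cast hp
  have hd0 : (0 : ℝ) < d := by exact_mod_cast hd
  have hst' : (s : ℝ) ≤ t := by exact_mod_cast hst
  have hmax : 0 < max ((d : ℝ) * p) (s + d) := lt_max_of_lt_left (by positivity)
  rw [noiseRadius, noiseRadius]
  gcongr

lemma radiusSq_mono (hp : 1 ≤ p) (hd : 1 ≤ d) (hB : 0 < B) (hφ : 0 ≤ φ d) :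
    Monotone (radiusSq p d B lam δ φ) := by
  intro s t hst
  rw [radiusSq_eq, radiusSq_eq]
  have := noiseRadius_mono (δ := δ) hp hd hB hst
  have hst' : (s : ℝ) ≤ t := by exact_mod_cast hst
  gcongr

lemma weightedNorm_sq_le_of_mem_confSet {x : ℕ → Vec p} {θhat θ : Vec p} {t : ℕ}
    (h : θ ∈ confSet d B lam δ φ x θhat t) :
    weightedNorm (featureCov lam x t) (θ - θhat) ^ 2 ≤ radiusSq p d B lam δ φ t := by
  have := h.2
  rw [radiusSq]
  linarith

lemma weightedNorm_sub_sq_le (hlam : 0 < lam) (x : ℕ → Vec p) (t : ℕ) (a b c : Vec p) :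
    weightedNorm (featureCov lam x t) (a - b) ^ 2 ≤
      2 * weightedNorm (featureCov lam x t) (a - c) ^ 2 +
        2 * weightedNorm (featureCov lam x t) (b - c) ^ 2 := by
  simp only [weightedNorm_sq hlam]
  have h1 : ∑ s ∈ Finset.Icc 1 t, inner ℝ (a - b) (x s) ^ 2 ≤
      2 * ∑ s ∈ Finset.Icc 1 t, inner ℝ (a - c) (x s) ^ 2 +
        2 * ∑ s ∈ Finset.Icc 1 t, inner ℝ (b - c) (x s) ^ 2 := by
    rw [Finset.mul_sum, Finset.mul_sum, ← Finset.sum_add_distrib]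
    refine Finset.sum_le_sum fun s _ => ?_
    rw [← sub_sub_sub_cancel_right a b c, inner_sub_left (a - c) (b - c)]
    nlinarith [sq_nonneg (inner ℝ (a - c) (x s) + inner ℝ (b - c) (x s))]
  have h2 : ‖a - b‖ ^ 2 ≤ 2 * ‖a - c‖ ^ 2 + 2 * ‖b - c‖ ^ 2 := by
    rw [← sub_sub_sub_cancel_right a b c]
    have := parallelogram_law_with_norm ℝ (a - c) (b - c)
    nlinarith [sq_nonneg ‖(a - c) + (b - c)‖]
  nlinarith [mul_le_mul_of_nonneg_left h2 hlam.le]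

/-- Optimism bounds the instantaneous regret by the confidence width. -/
lemma inner_sub_le_of_optimistic (hlam : 0 < lam) (hd : 1 ≤ d) {x : ℕ → Vec p} {θhat : Vec p}
    {t : ℕ} (ht : d < t) (hθs : θs ∈ confSet d B lam δ φ x θhat (t - d)) {a : Vec p}
    (hopt : ucb (confSet d B lam δ φ x θhat (t - d)) a ≤
      ucb (confSet d B lam δ φ x θhat (t - d)) (x t)) :
    inner ℝ a θs - inner ℝ (x t) θs ≤
      √(4 * radiusSq p d B lam δ φ (t - d) * blockPotential lam x d t) := by
  set C := confSet d B lam δ φ x θhat (t - d) with hC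
  have hbdd : BddAbove ((fun θ : Vec p => (inner ℝ a θ : ℝ)) '' C) := by
    refine ⟨‖a‖ * B, ?_⟩
    rintro _ ⟨θ, hθ, rfl⟩
    exact (real_inner_le_norm a θ).trans
      (mul_le_mul_of_nonneg_left (mem_closedBall_zero_iff.1 hθ.1) (norm_nonneg a))
  have h1 : inner ℝ a θs ≤ ucb C a := le_csSup hbdd ⟨θs, hθs, rfl⟩
  have h2 : ucb C (x t) ≤ inner ℝ (x t) θs +
      √(4 * radiusSq p d B lam δ φ (t - d) * blockPotential lam x d t) := by
    refine csSup_le ⟨_, θs, hθs, rfl⟩ ?_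
    rintro _ ⟨θ, hθ, rfl⟩
    have h3 : inner ℝ (x t) (θ - θs) ^ 2 ≤
        4 * radiusSq p d B lam δ φ (t - d) * blockPotential lam x d t := by
      refine (inner_sq_le_blockPotential_mul hlam x hd ht (θ - θs)).trans ?_
      rw [mul_comm]
      refine mul_le_mul_of_nonneg_right ?_ (blockPotential_nonneg hlam x d t)
      have h4 := weightedNorm_sub_sq_le hlam x (t - d) θ θs θhat
      have h5 := weightedNorm_sq_le_of_mem_confSet hθ
      have h6 := weightedNorm_sq_le_of_mem_confSet hθs
      linarith
    have h4 := Real.le_sqrt_of_sq_le h3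
    rw [inner_sub_right] at h4
    simp only
    linarith
  linarith

/-- A regret bound that beats the trivial one forces a minimal horizon. -/
lemma three_le_of_nontrivial (hp : 1 ≤ p) (hd : 1 ≤ d) {T : ℕ}
    (h : 8 * (d * p * Real.log (1 + B ^ 2 * T / (d * p))) < B ^ 2 * T) :
    3 ≤ d * p * Real.log (1 + B ^ 2 * T / (d * p)) := by
  have hdp : (0 : ℝ) < d * p := by
    have : 0 < d * p := Nat.mul_pos hd hp
    exact_mod_cast this
  set K := d * p * Real.log (1 + B ^ 2 * T / (d * p)) with hK
  have hy : 0 ≤ B ^ 2 * T / (d * p) := by positivity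
  have hK0 : 0 ≤ K := mul_nonneg hdp.le (Real.log_nonneg (by linarith))
  -- Bernoulli's inequality. The hypothesis then gives `1 + 8K < exp K`, which fails on `[0, 3]` by
  -- convexity, because `exp 3 ≤ 25 = 1 + 8 * 3`.
  have h1 : 1 + B ^ 2 * T ≤ Real.exp K := by
    have h2 := one_add_mul_le_pow (a := B ^ 2 * T / (d * p)) (by linarith) (d * p)
    have e1 : (1 + B ^ 2 * T / (d * p)) ^ (d * p) = Real.exp K := by
      rw [hK, ← Nat.cast_mul, Real.exp_nat_mul, Real.exp_log (by positivity)]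
    rw [e1] at h2
    push_cast at h2
    rwa [mul_div_cancel₀ _ hdp.ne'] at h2
  by_contra hlt
  push Not at hlt
  have hconv := convexOn_exp.2 (Set.mem_univ (0 : ℝ)) (Set.mem_univ (3 : ℝ))
    (show 0 ≤ 1 - K / 3 by linarith) (show 0 ≤ K / 3 by linarith) (by ring)
  have e2 : (1 - K / 3) • (0 : ℝ) + (K / 3) • (3 : ℝ) = K := by simp
  rw [e2, Real.exp_zero] at hconv
  have h3 : Real.exp 3 ≤ 25 := by
    have h4 : Real.exp 3 = Real.exp 1 ^ 3 := by rw [← Real.exp_nat_mul]; norm_num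
    have h5 := Real.exp_one_lt_d9
    rw [h4]
    calc Real.exp 1 ^ 3 ≤ (2.7182818286 : ℝ) ^ 3 := by gcongr
      _ ≤ 25 := by norm_num
  simp only [smul_eq_mul] at hconv
  nlinarith [mul_le_mul_of_nonneg_left h3 (show 0 ≤ K / 3 by linarith)]

end Regret

/-! ### Deterministic regret bound on a typical realisation. -/

section Regret

variable {p d : ℕ} {B δ : ℝ} {φ : ℕ → ℝ} {θs : Vec p}

/-- The instantaneous regret. -/
noncomputable def roundRegret (θs : Vec p) (D : ℕ → Set (Vec p)) (x : ℕ → Vec p) (t : ℕ) : ℝ :=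
  ⨆ a : D t, (inner ℝ (a : Vec p) θs - inner ℝ (x t) θs)

lemma roundRegret_le {D : ℕ → Set (Vec p)} {x : ℕ → Vec p} {t : ℕ} (hx : x t ∈ D t) {c : ℝ}
    (h : ∀ a ∈ D t, inner ℝ a θs - inner ℝ (x t) θs ≤ c) : roundRegret θs D x t ≤ c := by
  have : Nonempty (D t) := ⟨⟨x t, hx⟩⟩
  exact ciSup_le fun a => h a a.2

lemma roundRegret_le_two_mul (hθs : θs ∈ Metric.closedBall (0 : Vec p) B)
    {D : ℕ → Set (Vec p)} {x : ℕ → Vec p} {t : ℕ} (hx : x t ∈ D t)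
    (hD : D t ⊆ Metric.closedBall (0 : Vec p) 1) : roundRegret θs D x t ≤ 2 * B := by
  refine roundRegret_le hx fun a ha => ?_
  have hθ := mem_closedBall_zero_iff.1 hθs
  have key : ∀ b ∈ D t, |inner ℝ b θs| ≤ B := fun b hb =>
    (abs_real_inner_le_norm b θs).trans (by
      have := mem_closedBall_zero_iff.1 (hD hb)
      calc ‖b‖ * ‖θs‖ ≤ 1 * B := by gcongr
        _ = B := one_mul B)
  linarith [(abs_le.1 (key a ha)).2, (abs_le.1 (key _ hx)).1]

/-- The rounds whose delayed confidence set misses the true parameter are few. -/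
lemma card_filter_mul_le {T : ℕ} {P : ℕ → Prop} [DecidablePred P] {N : ℕ → ℝ} (hN : Monotone N)
    (hN0 : ∀ t, 0 ≤ N t) {c : ℝ} (hc : 0 ≤ c) (hPd : ∀ t, P t → d < t)
    (hP : ∀ t, P t → c * (t - d : ℕ) ≤ N (t - d)) :
    c * ((Finset.Icc 1 T).filter P).card ≤ N T := by
  rcases ((Finset.Icc 1 T).filter P).eq_empty_or_nonempty with h | h
  · simpa [h] using hN0 T
  -- All rounds satisfying `P` lie in `(d, m]` with `m` the last of them, so its inequality bounds
  -- their number.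
  · set m := ((Finset.Icc 1 T).filter P).max' h with hm
    have hmem := Finset.mem_filter.1 (Finset.max'_mem _ h)
    rw [← hm] at hmem
    have hsub : (Finset.Icc 1 T).filter P ⊆ Finset.Ioc d m := by
      intro t ht
      exact Finset.mem_Ioc.2 ⟨hPd t (Finset.mem_filter.1 ht).2, Finset.le_max' _ t ht⟩
    have hcard : (((Finset.Icc 1 T).filter P).card : ℝ) ≤ (m - d : ℕ) := by
      have := Finset.card_le_card hsub
      rw [Nat.card_Ioc] at this
      exact_mod_cast this
    calc _ ≤ c * (m - d : ℕ) := by gcongr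
      _ ≤ N (m - d) := hP m hmem.2
      _ ≤ N T := hN ((Nat.sub_le _ _).trans (Finset.mem_Icc.1 hmem.1).2)

/-- The regret bound on a realisation on which the noise is well behaved. -/
lemma regret_le_of_typical (hp : 1 ≤ p) (hd : 1 ≤ d) (hB : 0 < B) (hδ : δ ∈ Set.Ioo (0 : ℝ) 1)
    (hθs : θs ∈ Metric.closedBall (0 : Vec p) B) {D : ℕ → Set (Vec p)}
    (hD : ∀ t, 1 ≤ t → D t ⊆ Metric.closedBall (0 : Vec p) 1) (hφ0 : 0 ≤ φ d)
    {x θhat : ℕ → Vec p} {y e z : ℕ → ℝ} (hx : ∀ t, 1 ≤ t → x t ∈ D t)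
    (hls : ∀ t, 1 ≤ t → IsLeastSquares B x y t (θhat t))
    (hy : ∀ s, y s = inner ℝ θs (x s) + e s) (hez : ∀ s, 1 ≤ s → |e s - z s| ≤ φ d)
    (hz : ∀ t (θ : Vec p), ‖θ‖ ≤ B → ∑ s ∈ Finset.Icc 1 t, (inner ℝ (θ - θs) (x s) * z s
      - inner ℝ (θ - θs) (x s) ^ 2 / 2) ≤ noiseRadius p d B δ t)
    (hopt : ∀ t, d < t → ∀ a ∈ D t,
      ucb (confSet d B (1 / B ^ 2) δ φ x (θhat (t - d)) (t - d)) a ≤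
        ucb (confSet d B (1 / B ^ 2) δ φ x (θhat (t - d)) (t - d)) (x t)) (T : ℕ) :
    regret θs D x T ≤ 2 * d * B +
      √(8 * d * p * T * max (B ^ 2) (radiusSq p d B (1 / B ^ 2) δ φ T) *
        Real.log (1 + B ^ 2 * T / (d * p))) := by
  have hdp : (0 : ℝ) < d * p := by
    have : 0 < d * p := Nat.mul_pos hd hp
    exact_mod_cast this
  have hlam : 0 < 1 / B ^ 2 := by positivity
  set r : ℕ → ℝ := roundRegret θs D x with hr
  set R := radiusSq p d B (1 / B ^ 2) δ φ T with hR
  set m := max (B ^ 2) R with hm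
  set K := d * p * Real.log (1 + B ^ 2 * T / (d * p)) with hK
  have hm0 : 0 < m := lt_max_of_lt_left (by positivity)
  have hK0 : 0 ≤ K := mul_nonneg hdp.le (Real.log_nonneg (by
    have : 0 ≤ B ^ 2 * T / (d * p) := by positivity
    linarith))
  have e0 : 8 * d * p * T * m * Real.log (1 + B ^ 2 * T / (d * p)) = T * (8 * m * K) := by
    rw [hK]; ring
  have hregret : regret θs D x T = ∑ t ∈ Finset.Icc 1 T, r t := rfl
  have hr2B : ∀ t, 1 ≤ t → r t ≤ 2 * B := fun t ht =>
    roundRegret_le_two_mul hθs (hx t ht) (hD t ht)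
  rw [e0, hregret]
  have hN0 : ∀ t, 0 ≤ noiseRadius p d B δ t := noiseRadius_nonneg hp hd hB hδ
  have hReq : R = 2 * noiseRadius p d B δ T + 4 + 2 * T * φ d * (B + 1) := by
    rw [hR, radiusSq_eq]; field_simp
  have hφT : 0 ≤ 2 * T * φ d * (B + 1) := by positivity
  -- In the first case the trivial bound `2BT` is already below the square root.
  rcases le_or_gt (B ^ 2 * T) (2 * K * m) with htriv | hnon
  · have h1 : ∑ t ∈ Finset.Icc 1 T, r t ≤ T * (2 * B) := by
      calc _ ≤ ∑ t ∈ Finset.Icc 1 T, 2 * B :=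
            Finset.sum_le_sum fun t ht => hr2B t (Finset.mem_Icc.1 ht).1
        _ = T * (2 * B) := by simp
    have h2 : T * (2 * B) ≤ √(T * (8 * m * K)) := by
      refine Real.le_sqrt_of_sq_le ?_
      calc (T * (2 * B)) ^ 2 = T * (4 * (B ^ 2 * T)) := by ring
        _ ≤ T * (4 * (2 * K * m)) := by gcongr
        _ = _ := by ring
    have h3 : 0 ≤ 2 * d * B := by positivity
    linarith
  have hRm : R ≤ m := le_max_right _ _
  have hT0 : (0 : ℝ) < T := by
    by_contra hT
    have : (T : ℝ) = 0 := le_antisymm (not_lt.1 hT) (Nat.cast_nonneg T)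
    rw [this, mul_zero] at hnon
    have : 0 ≤ 2 * K * m := by positivity
    linarith
  have hK3 : 3 ≤ K := by
    refine three_le_of_nontrivial hp hd (lt_of_le_of_lt ?_ hnon)
    -- The regularisation term of the radius is `4 lam B² = 4` for `lam = 1 / B²`.
    have h4 : 4 ≤ m := by linarith [hN0 T]
    calc 8 * K = 2 * K * 4 := by ring
      _ ≤ 2 * K * m := by gcongr
  -- The bias term is part of `R ≤ m`, and `6m ≤ 2Km < B²T`.
  have hφ : φ d ≤ (B + 1) / 12 := by
    have h1 : 2 * T * φ d * (B + 1) ≤ m := by linarith [hN0 T]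
    have h2 : T * (12 * (φ d * (B + 1))) < T * (B + 1) ^ 2 := by
      calc T * (12 * (φ d * (B + 1))) = 2 * 3 * (2 * T * φ d * (B + 1)) := by ring
        _ ≤ 2 * K * m := by gcongr
        _ < B ^ 2 * T := hnon
        _ ≤ T * (B + 1) ^ 2 := by rw [mul_comm]; gcongr; linarith
    have h3 := lt_of_mul_lt_mul_left h2 hT0.le
    have h4 : 12 * φ d * (B + 1) < (B + 1) * (B + 1) := by linarith
    have h5 := lt_of_mul_lt_mul_right h4 (by linarith)
    linarith
  classical
  set P : ℕ → Prop := fun t => d < t ∧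
    θs ∉ confSet d B (1 / B ^ 2) δ φ x (θhat (t - d)) (t - d) with hP
  set q : ℕ → ℝ := fun t => min 1 (blockPotential (1 / B ^ 2) x d t) with hq
  have hq0 : ∀ t, 0 ≤ q t := fun t => le_min zero_le_one (blockPotential_nonneg hlam x d t)
  set b : ℕ → ℝ := fun t => if P t then 2 * B else √(4 * m * q t) with hb
  have hb0 : ∀ t, 0 ≤ b t := by
    intro t
    by_cases h : P t
    · simp only [hb, if_pos h]; positivity
    · simp only [hb, if_neg h]; positivity
  -- The count times `B²` is at most 12/5 of the noise radius, itself at most `R/2`; then `6R/5 ≤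
  -- 3R/2 ≤ KR/2`.
  have hbad : B ^ 2 * ((Finset.Icc 1 T).filter P).card ≤ K * R / 2 := by
    have h1 := card_filter_mul_le (d := d) (T := T) (P := P)
      (noiseRadius_mono (δ := δ) hp hd hB) hN0
      (c := 5 / 12 * (B + 1) ^ 2) (by positivity) (fun t ht => ht.1) (fun t ht =>
        (mem_confSet_or hB hlam hθs (hls (t - d) (by have := ht.1; omega)) hy hez
          (hz _ _ (mem_closedBall_zero_iff.1 (hls (t - d) (by have := ht.1; omega)).1))
          hφ0 hφ).resolve_left ht.2)
    have h2 : B ^ 2 * (((Finset.Icc 1 T).filter P).card : ℝ) ≤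
        (B + 1) ^ 2 * ((Finset.Icc 1 T).filter P).card := by gcongr; linarith
    have h3 : 3 * R ≤ K * R := by
      have : 0 ≤ R := by linarith [hN0 T]
      gcongr
    linarith [hN0 T]
  have hround : ∀ t ∈ Finset.Icc 1 T, r t ≤ (if t ≤ d then 2 * B else 0) + b t := by
    intro t ht
    have ht1 := (Finset.mem_Icc.1 ht).1
    by_cases htd : t ≤ d
    · rw [if_pos htd]
      linarith [hr2B t ht1, hb0 t]
    rw [if_neg htd, zero_add]
    have htd' : d < t := not_le.1 htd
    by_cases hPt : P t
    · simpa only [hb, if_pos hPt] using hr2B t ht1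
    simp only [hb, if_neg hPt]
    have hmem : θs ∈ confSet d B (1 / B ^ 2) δ φ x (θhat (t - d)) (t - d) := by
      by_contra h
      exact hPt ⟨htd', h⟩
    -- Where the potential exceeds 1 the trivial bound `2B ≤ √(4m)` takes over, which is why `m`
    -- includes `B²`.
    rcases le_total 1 (blockPotential (1 / B ^ 2) x d t) with h | h
    · refine (hr2B t ht1).trans (Real.le_sqrt_of_sq_le ?_)
      simp only [hq, min_eq_left h]
      have : B ^ 2 ≤ m := le_max_left _ _
      linarith
    · refine roundRegret_le (hx t ht1) fun a ha =>
        (inner_sub_le_of_optimistic hlam hd htd' hmem (hopt t htd' a ha)).trans ?_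
      simp only [hq, min_eq_right h]
      refine Real.sqrt_le_sqrt (mul_le_mul_of_nonneg_right ?_ (blockPotential_nonneg hlam x d t))
      have : radiusSq p d B (1 / B ^ 2) δ φ (t - d) ≤ R :=
        radiusSq_mono hp hd hB hφ0 ((Nat.sub_le _ _).trans (Finset.mem_Icc.1 ht).2)
      linarith
  have hfirst : ∑ t ∈ Finset.Icc 1 T, (if t ≤ d then 2 * B else 0) ≤ 2 * d * B := by
    rw [← Finset.sum_filter, Finset.sum_const, nsmul_eq_mul]
    have hsub : (Finset.Icc 1 T).filter (fun t => t ≤ d) ⊆ Finset.Icc 1 d := by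
      intro t ht
      simp only [Finset.mem_filter, Finset.mem_Icc] at ht ⊢
      omega
    have hcard : (((Finset.Icc 1 T).filter (fun t => t ≤ d)).card : ℝ) ≤ d := by
      have := Finset.card_le_card hsub
      rw [Nat.card_Icc, Nat.add_sub_cancel] at this
      exact_mod_cast this
    calc _ ≤ (d : ℝ) * (2 * B) := by gcongr
      _ = _ := by ring
  -- The potentials contribute `4m * 3K/2 = 6mK`, the missed rounds at most `2KR ≤ 2mK`.
  have hsq : ∑ t ∈ Finset.Icc 1 T, b t ^ 2 ≤ 8 * m * K := by
    have h1 : ∀ t ∈ Finset.Icc 1 T, b t ^ 2 ≤ 4 * m * q t + (if P t then 4 * B ^ 2 else 0) := by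
      intro t _
      have h4 : 0 ≤ 4 * m * q t := mul_nonneg (by positivity) (hq0 t)
      by_cases h : P t
      · simp only [hb, if_pos h]; nlinarith
      · simp only [hb, if_neg h, Real.sq_sqrt h4, add_zero, le_refl]
    have h2 := sum_blockPotential_le hp hlam x hd
      (fun s hs => mem_closedBall_zero_iff.1 (hD s hs (hx s hs))) T
    have e1 : (T : ℝ) / (1 / B ^ 2 * (d * p)) = B ^ 2 * T / (d * p) := by field_simp
    rw [e1, ← hK] at h2
    calc _ ≤ ∑ t ∈ Finset.Icc 1 T, (4 * m * q t + (if P t then 4 * B ^ 2 else 0)) :=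
          Finset.sum_le_sum h1
      _ = 4 * m * ∑ t ∈ Finset.Icc 1 T, q t +
            4 * (B ^ 2 * ((Finset.Icc 1 T).filter P).card) := by
          rw [Finset.sum_add_distrib, ← Finset.mul_sum, ← Finset.sum_filter, Finset.sum_const,
            nsmul_eq_mul]
          ring
      _ ≤ 4 * m * (3 / 2 * K) + 4 * (K * R / 2) := by gcongr
      _ ≤ 4 * m * (3 / 2 * K) + 4 * (K * m / 2) := by gcongr
      _ = 8 * m * K := by ring
  have hCS : ∑ t ∈ Finset.Icc 1 T, b t ≤ √(T * (8 * m * K)) := by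
    refine Real.le_sqrt_of_sq_le ?_
    refine sq_sum_le_card_mul_sum_sq.trans ?_
    rw [Nat.card_Icc, Nat.add_sub_cancel]
    gcongr
  calc _ ≤ ∑ t ∈ Finset.Icc 1 T, ((if t ≤ d then 2 * B else 0) + b t) := Finset.sum_le_sum hround
    _ ≤ _ := by rw [Finset.sum_add_distrib]; gcongr

end Regret

end MixingBandit

/-! ### Assembly on the probability space. -/

theorem theorem2 {Ω : Type*} [MeasurableSpace Ω] (μ : Measure Ω) [IsProbabilityMeasure μ]
    (p : ℕ) (hp : 1 ≤ p)
    (B : ℝ) (hB : 0 < B)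
    (θs : MixingBandit.Vec p) (hθs : θs ∈ Metric.closedBall (0 : MixingBandit.Vec p) B)
    (D : ℕ → Set (MixingBandit.Vec p))
    (hD : ∀ t, 1 ≤ t → D t ⊆ Metric.closedBall (0 : MixingBandit.Vec p) 1)
    (φ : ℕ → ℝ) (ε : ℕ → Ω → ℝ) (hε : MixingBandit.IsMixingSubGaussian μ ε 1 φ)
    (d : ℕ) (hd : 1 ≤ d) (δ : ℝ) (hδ : δ ∈ Set.Ioo (0 : ℝ) 1)
    (X θhat : ℕ → Ω → MixingBandit.Vec p)
    (hX : MixingBandit.IsMixingLinUCB ε θs D d B (1 / B ^ 2) δ φ X θhat) :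
    ENNReal.ofReal (1 - δ) ≤
      μ {ω | ∀ T : ℕ, d < T →
        MixingBandit.regret θs D (fun t => X t ω) T ≤
          2 * d * B +
            √(8 * d * p * T * max (B ^ 2) (MixingBandit.radiusSq p d B (1 / B ^ 2) δ φ T) *
              Real.log (1 + B ^ 2 * T / (d * p)))} := by
  open MixingBandit in
  have hXm : ∀ t, 1 ≤ t → Measurable[noiseSigma ε (t - d)] (X t) := by
    intro t ht
    rcases Nat.lt_or_ge d t with h | h
    · exact hX.adapted t h
    · obtain ⟨x₀, hx₀⟩ := hX.init t ht h
      rw [show X t = fun _ => x₀ from funext hx₀]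
      exact measurable_const
  have hX1 : ∀ t, 1 ≤ t → ∀ ω, ‖X t ω‖ ≤ 1 := fun t ht ω =>
    mem_closedBall_zero_iff.1 (hD t ht (hX.mem t ht ω))
  have hbad := measure_badEvent_le (θs := θs) hp hd hB hδ.1 hε hXm hX1
  have hmean : ∀ᵐ ω ∂μ, ∀ t, 1 ≤ t → |(μ[ε t | noiseSigma ε (t - d)]) ω| ≤ φ d :=
    ae_all_iff.2 fun t => Filter.eventually_imp_distrib_left.2 fun ht => condMean_le hε hd ht
  set S := {ω | ∀ T : ℕ, d < T → regret θs D (fun t => X t ω) T ≤ 2 * d * B +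
    √(8 * d * p * T * max (B ^ 2) (radiusSq p d B (1 / B ^ 2) δ φ T) *
      Real.log (1 + B ^ 2 * T / (d * p)))} with hS
  -- Failure needs an atypical likelihood ratio or the null event where some conditional mean
  -- exceeds `φ d`.
  have hsub : Sᶜ ⊆ badEvent μ d B δ ε θs X ∪
      {ω | ¬ ∀ t, 1 ≤ t → |(μ[ε t | noiseSigma ε (t - d)]) ω| ≤ φ d} := by
    intro ω hω
    by_contra hgood
    rw [Set.mem_union, not_or] at hgood
    have hm : ∀ t, 1 ≤ t → |(μ[ε t | noiseSigma ε (t - d)]) ω| ≤ φ d := not_not.1 hgood.2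
    refine hω fun T _ => ?_
    exact regret_le_of_typical (x := fun t => X t ω) (θhat := fun t => θhat t ω)
      (y := fun s => reward θs ε X s ω) (e := fun s => ε s ω)
      (z := fun s => centredNoise μ ε d s ω) hp hd hB hδ hθs hD (hε.coeff_nonneg d)
      (fun t ht => hX.mem t ht ω) (fun t ht => hX.leastSquares t ht ω) (fun _ => rfl)
      (fun s hs => by simpa [centredNoise] using hm s hs)
      (fun t θ hθ => sum_logRatio_le hp hd hB hgood.1 t hθ)
      (fun t ht a ha => hX.optimistic t ht ω a ha) T
  have hSc : μ Sᶜ ≤ ENNReal.ofReal δ :=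
    calc μ Sᶜ ≤ _ := measure_mono hsub
      _ ≤ _ := measure_union_le _ _
      _ = μ (badEvent μ d B δ ε θs X) := by rw [ae_iff.1 hmean, add_zero]
      _ ≤ _ := hbad
  -- Subadditivity suffices here, so measurability of `S` is never required.
  have h1 : 1 ≤ μ S + μ Sᶜ := by
    rw [← measure_univ (μ := μ), ← Set.union_compl_self S]
    exact measure_union_le _ _
  rw [ENNReal.ofReal_sub _ hδ.1.le, ENNReal.ofReal_one]
  refine tsub_le_iff_right.2 (h1.trans ?_)
  gcongr
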